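/- Let $E$ be a non-archimedean local field of characteristic zero with a non-trivial involution $\theta$ and let $F$ be the fixed field of $\theta$, a local field with the topology of $E$. For $K\in\{E,F\}$ let $\mathcal O_K$ be the ring of integers and $q_K$ the number of elements of the residue field; let $|\cdot|_E$ be the absolute value of $E$ with $|\varpi_E|_E=q_E^{-1}$ for a uniformizer $\varpi_E$. Fix $\omega\in E\setminus F$ with $\omega^2=a\in F\setminus\{0\}$, so that $E=F\oplus F\omega$. For a square matrix $x$ over $E$ put $x^*={}^t\theta(x)$. Let $T=\mathrm{diag}(d_1,\dots,d_m)$ with $d_1,\dots,d_m\in F^\times$, and let $$G=\{g\in \mathrm{GL}_m(E) : g^*Tg=T\},\qquad \mathfrak g=\{x\in M_m(E): x^*T+Tx=0\},$$ $$\mathfrak g'=\{y\in\mathfrak g : \det\big((I_m+y)(I_m-y)\big)\neq 0\},\qquad \mathcal C:\mathfrak g'\to G,\quad \mathcal C(y)=(I_m+y)(I_m-y)^{-1}.$$ Let $w_m$ be the matrix with ones on the second diagonal and zeros elsewhere. On the space of matrices $x\in M_m(E)$ with $(w_mx)^*=-(w_mx)$ let $$dx=\prod_{i+j<m+1}dx_{ij}\prod_{i+j=m+1}dx^{(\omega)}_{ij},$$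 where $dx_{ij}$ is the Haar measure of $E$ that gives $\mathcal O_E$ the measure $1$ and $dx^{(\omega)}_{ij}$ is the Haar measure of $F\omega$ that gives $\mathcal O_F\omega$ the measure $1$. Let $\mu$ be the measure on $\mathfrak g$ given by $d\mu(y)=dx$ for $y=xw_mT$. Then there is a Haar measure $dh$ on $G$ such that for every $f\in C_c^\infty(G)$ (that is, $f:G\to\mathbb C$ locally constant with compact support) for which the function $y\mapsto |f(\mathcal C(y))|\,|\det(I_m-y)|_E^{-m}$ on $\mathfrak g'$, extended by $0$ to $\mathfrak g$, is $\mu$-integrable, one has $$\int_{\mathfrak g'}f(\mathcal C(y))\,|\det(I_m-y)|_E^{-m}\,d\mu(y)=\int_G f(h)\,|\det h|_E^{m/2}\,dh=\int_G f(h)\,dh.$$ -/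

import Mathlib

open MeasureTheory ValuativeRel
open scoped Matrix NNReal

namespace CayleyUnitary

noncomputable section

/-! ### Non-archimedean local fields -/

section LocalField

variable (K : Type*) [Field K] [ValuativeRel K] [TopologicalSpace K]
  [IsNonarchimedeanLocalField K]

/-- The number `q_K` of elements of the residue field, as a nonnegative real. -/
def residueCard : ℝ≥0 := (Nat.card 𝓀[K] : ℝ≥0)

lemma residueCard_ne_zero : residueCard K ≠ 0 := by
  unfold residueCard
  exact_mod_cast (Nat.card_pos (α := 𝓀[K])).ne'

variable {K} in
/-- The normalized absolute value `|x|_K`, for which a uniformizer has absolute value `q_K⁻¹`: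
the value group is identified with the powers of one element, `exp (-1)` being the value of a
uniformizer, and `exp n` is sent to `q_K ^ n`. -/
def absVal (x : K) : ℝ :=
  (WithZeroMulInt.toNNReal (residueCard_ne_zero K)
    (IsNonarchimedeanLocalField.valueGroupWithZeroIsoInt K (valuation K x)) : ℝ)

/-- The ring of integers as a compact set with nonempty interior. -/
def integersCompacts : TopologicalSpace.PositiveCompacts K where
  carrier := {x | valuation K x ≤ 1}
  isCompact' := IsNonarchimedeanLocalField.isCompact_closedBall K 1
  interior_nonempty' := by
    refine ⟨0, mem_interior_iff_mem_nhds.2 ?_⟩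
    refine (IsValuativeTopology.hasBasis_nhds_zero' K).mem_iff.2 ⟨1, one_ne_zero, ?_⟩
    intro x hx
    simp only [Set.mem_ofPred_eq] at hx ⊢
    exact hx.le

/-- The additive Haar measure of `K` that gives the ring of integers the measure `1`. -/
def haarO [MeasurableSpace K] [BorelSpace K] : Measure K :=
  Measure.addHaarMeasure (integersCompacts K)

end LocalField

/-! ### The unitary group, its Lie algebra and the Cayley transform -/

section Unitary

variable {E : Type*} [Field E] (θ : E ≃+* E) {m : ℕ}

/-- `x^* = ᵗθ(x)`. -/
def conjT (x : Matrix (Fin m) (Fin m) E) : Matrix (Fin m) (Fin m) E := (x.map θ)ᵀ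

lemma conjT_mul (x y : Matrix (Fin m) (Fin m) E) :
    conjT θ (x * y) = conjT θ y * conjT θ x := by
  simp [conjT, Matrix.map_mul, Matrix.transpose_mul]

lemma conjT_one : conjT θ (1 : Matrix (Fin m) (Fin m) E) = 1 := by
  simp [conjT, Matrix.map_one]

lemma conjT_add (x y : Matrix (Fin m) (Fin m) E) :
    conjT θ (x + y) = conjT θ x + conjT θ y := by
  ext; simp [conjT]

lemma conjT_neg (x : Matrix (Fin m) (Fin m) E) : conjT θ (-x) = -conjT θ x := by
  ext; simp [conjT]

lemma conjT_sub (x y : Matrix (Fin m) (Fin m) E) :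
    conjT θ (x - y) = conjT θ x - conjT θ y := by
  ext; simp [conjT]

/-- The unitary group `G = U_m(T) = {g ∈ GL_m(E) | g^* T g = T}`. -/
def unitaryGrp (T : Matrix (Fin m) (Fin m) E) : Subgroup (GL (Fin m) E) where
  carrier := {g | conjT θ (g : Matrix (Fin m) (Fin m) E) * T * g = T}
  one_mem' := by simp [conjT_one]
  mul_mem' := by
    intro g h hg hh
    simp only [Set.mem_ofPred_eq, Units.val_mul, conjT_mul] at *
    calc conjT θ h.val * conjT θ g.val * T * (g.val * h.val)
        = conjT θ h.val * (conjT θ g.val * T * g.val) * h.val := by simp only [Matrix.mul_assoc]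
      _ = T := by rw [hg, hh]
  inv_mem' := by
    intro g hg
    simp only [Set.mem_ofPred_eq] at *
    have h1 : g.val * (g⁻¹).val = 1 := by rw [← Units.val_mul]; simp
    have h2 : conjT θ (g⁻¹).val * conjT θ g.val = 1 := by rw [← conjT_mul, h1, conjT_one]
    calc conjT θ (g⁻¹).val * T * (g⁻¹).val
        = conjT θ (g⁻¹).val * (conjT θ g.val * T * g.val) * (g⁻¹).val := by rw [hg]
      _ = (conjT θ (g⁻¹).val * conjT θ g.val) * T * (g.val * (g⁻¹).val) := by
          simp only [Matrix.mul_assoc]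
      _ = T := by rw [h1, h2]; simp

/-- The Lie algebra `𝔤 = {x ∈ M_m(E) | x^* T + T x = 0}`. -/
def lieAlg (T : Matrix (Fin m) (Fin m) E) : AddSubgroup (Matrix (Fin m) (Fin m) E) where
  carrier := {x | conjT θ x * T + T * x = 0}
  zero_mem' := by simp [conjT]
  add_mem' := by
    intro x y hx hy
    simp only [Set.mem_ofPred_eq, conjT_add, add_mul, mul_add] at *
    rw [add_add_add_comm, hx, hy, add_zero]
  neg_mem' := by
    intro x hx
    simp only [Set.mem_ofPred_eq, conjT_neg, neg_mul, mul_neg] at *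
    rw [← neg_add, hx, neg_zero]

/-- `𝔤' = {y ∈ 𝔤 | det ((I + y) (I - y)) ≠ 0}`, the domain of the Cayley transform. -/
def lieAlg' (T : Matrix (Fin m) (Fin m) E) : Set (lieAlg θ T) :=
  {y | ((1 + (y : Matrix (Fin m) (Fin m) E)) * (1 - (y : Matrix (Fin m) (Fin m) E))).det ≠ 0}

/-- The Cayley transform `𝒞(y) = (I + y) (I - y)⁻¹` from `𝔤'` to `G`. -/
def cayley (T : Matrix (Fin m) (Fin m) E) (y : lieAlg' θ T) : unitaryGrp θ T :=
  ⟨Matrix.nonsingInvUnit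
      ((1 + (y.1 : Matrix (Fin m) (Fin m) E)) * (1 - (y.1 : Matrix (Fin m) (Fin m) E))⁻¹) (by
        have h := y.2
        simp only [lieAlg', Set.mem_ofPred_eq, Matrix.det_mul, mul_ne_zero_iff] at h
        rw [isUnit_iff_ne_zero, Matrix.det_mul, Matrix.det_nonsing_inv, Ring.inverse_eq_inv']
        exact mul_ne_zero h.1 (inv_ne_zero h.2)), by
    obtain ⟨⟨y, hy⟩, h⟩ := y
    change ((1 + y) * (1 - y)).det ≠ 0 at h
    rw [Matrix.det_mul, mul_ne_zero_iff] at h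
    change conjT θ y * T + T * y = 0 at hy
    have hy' : conjT θ y * T = -(T * y) := eq_neg_of_add_eq_zero_left hy
    change conjT θ ((1 + y) * (1 - y)⁻¹) * T * ((1 + y) * (1 - y)⁻¹) = T
    have hu : IsUnit (1 - y).det := isUnit_iff_ne_zero.2 h.2
    have h1 : (1 - y) * (1 - y)⁻¹ = 1 := Matrix.mul_nonsing_inv _ hu
    have h2 : conjT θ (1 - y)⁻¹ * conjT θ (1 - y) = 1 := by rw [← conjT_mul, h1, conjT_one]
    have h3 : conjT θ (1 + y) * T * (1 + y) = conjT θ (1 - y) * T * (1 - y) := by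
      rw [conjT_add, conjT_sub, conjT_one, add_mul, sub_mul, hy']
      noncomm_ring
    calc conjT θ ((1 + y) * (1 - y)⁻¹) * T * ((1 + y) * (1 - y)⁻¹)
        = conjT θ (1 - y)⁻¹ * (conjT θ (1 + y) * T * (1 + y)) * (1 - y)⁻¹ := by
          rw [conjT_mul]; simp only [Matrix.mul_assoc]
      _ = (conjT θ (1 - y)⁻¹ * conjT θ (1 - y)) * T * ((1 - y) * (1 - y)⁻¹) := by
          rw [h3]; simp only [Matrix.mul_assoc]
      _ = T := by rw [h1, h2]; simp⟩

/-- The determinant of an element of `G`. -/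
def detG (T : Matrix (Fin m) (Fin m) E) (g : unitaryGrp θ T) : E :=
  (g.1 : Matrix (Fin m) (Fin m) E).det

/-! ### Matrices that are skew-hermitian with respect to the second diagonal -/

/-- The matrix `w_m` with ones on the second diagonal and zeros elsewhere. -/
def wMat (E : Type*) [Field E] (m : ℕ) : Matrix (Fin m) (Fin m) E :=
  Matrix.of fun i j => if j = i.rev then 1 else 0

/-- The space of matrices `x` with `(w_m x)^* = -(w_m x)`. -/
def antiSkew (m : ℕ) : AddSubgroup (Matrix (Fin m) (Fin m) E) where
  carrier := {x | conjT θ (wMat E m * x) = -(wMat E m * x)}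
  zero_mem' := by simp [conjT]
  add_mem' := by
    intro x y hx hy
    simp only [Set.mem_ofPred_eq, mul_add, conjT_add, neg_add] at *
    rw [hx, hy]
  neg_mem' := by
    intro x hx
    simp only [Set.mem_ofPred_eq, mul_neg, conjT_neg] at *
    rw [hx]

lemma wMat_mul_apply (x : Matrix (Fin m) (Fin m) E) (i j : Fin m) :
    (wMat E m * x) i j = x i.rev j := by
  simp [wMat, Matrix.mul_apply]

lemma mul_wMat_apply (x : Matrix (Fin m) (Fin m) E) (i j : Fin m) :
    (x * wMat E m) i j = x i j.rev := by
  have : ∀ k : Fin m, (j = k.rev) = (k = j.rev) := by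
    intro k; rw [eq_iff_iff]; constructor <;> (rintro rfl; simp)
  simp [wMat, Matrix.mul_apply, this]

lemma mem_antiSkew_iff (x : Matrix (Fin m) (Fin m) E) :
    x ∈ antiSkew θ m ↔ ∀ i j, θ (x j.rev i) = -x i.rev j := by
  change conjT θ (wMat E m * x) = -(wMat E m * x) ↔ _
  simp only [← Matrix.ext_iff, conjT, Matrix.transpose_apply, Matrix.map_apply,
    Matrix.neg_apply, wMat_mul_apply]

/-- The positions strictly above the second diagonal (`i + j < m + 1` for indices that start
at `1`). -/
abbrev AbovePos (m : ℕ) : Type := {p : Fin m × Fin m // p.1.val + p.2.val + 1 < m}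

variable {F : Type*} [Field F] [Algebra F E]

/-- The matrix, skew-hermitian with respect to the second diagonal, whose entries above that
diagonal are `c.1` and whose entries on that diagonal are `c.2 i * ω`. -/
def skewOfCoords (ω : E) (c : (AbovePos m → E) × (Fin m → F)) : Matrix (Fin m) (Fin m) E :=
  Matrix.of fun i j =>
    if h : i.val + j.val + 1 < m then c.1 ⟨(i, j), h⟩
    else if h' : i.val + j.val + 1 = m then algebraMap F E (c.2 i) * ω
    else -θ (c.1 ⟨(j.rev, i.rev), by simp only [Fin.val_rev]; omega⟩)

lemma skewOfCoords_mem (hθ : ∀ x, θ (θ x) = x) (hF : ∀ c : F, θ (algebraMap F E c) = algebraMap F E c)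
    {ω : E} (hω : θ ω = -ω) (c : (AbovePos m → E) × (Fin m → F)) :
    skewOfCoords θ ω c ∈ antiSkew θ m := by
  rw [mem_antiSkew_iff]
  intro i j
  have hi := i.isLt
  have hj := j.isLt
  rcases lt_trichotomy i.val j.val with h | h | h
  · have h1 : j.rev.val + i.val + 1 < m := by simp only [Fin.val_rev]; omega
    have h2 : ¬ i.rev.val + j.val + 1 < m := by simp only [Fin.val_rev]; omega
    have h3 : ¬ i.rev.val + j.val + 1 = m := by simp only [Fin.val_rev]; omega
    simp only [skewOfCoords, Matrix.of_apply, dif_pos h1, dif_neg h2, dif_neg h3, neg_neg,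
      Fin.rev_rev]
  · obtain rfl : i = j := Fin.ext h
    have h2 : ¬ i.rev.val + i.val + 1 < m := by simp only [Fin.val_rev]; omega
    have h3 : i.rev.val + i.val + 1 = m := by simp only [Fin.val_rev]; omega
    simp only [skewOfCoords, Matrix.of_apply, dif_neg h2, dif_pos h3, map_mul, hF, hω, mul_neg]
  · have h1 : i.rev.val + j.val + 1 < m := by simp only [Fin.val_rev]; omega
    have h2 : ¬ j.rev.val + i.val + 1 < m := by simp only [Fin.val_rev]; omega
    have h3 : ¬ j.rev.val + i.val + 1 = m := by simp only [Fin.val_rev]; omega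
    simp only [skewOfCoords, Matrix.of_apply, dif_pos h1, dif_neg h2, dif_neg h3, Fin.rev_rev,
      map_neg, hθ]

lemma conjT_wMat : conjT θ (wMat E m) = wMat E m := by
  ext i j
  have : (i = j.rev) = (j = i.rev) := by
    rw [eq_iff_iff]; constructor <;> (rintro rfl; simp)
  simp only [conjT, wMat, Matrix.transpose_apply, Matrix.map_apply, Matrix.of_apply, this]
  split_ifs <;> simp

lemma wMat_mul_wMat : wMat E m * wMat E m = 1 := by
  ext i j
  rw [wMat_mul_apply]
  simp [wMat, Matrix.one_apply, eq_comm]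

/-- If `x` is skew-hermitian with respect to the second diagonal, then `x w_m T` lies in `𝔤`. -/
lemma mul_wMat_mul_mem {T : Matrix (Fin m) (Fin m) E} (hT : conjT θ T = T)
    {x : Matrix (Fin m) (Fin m) E} (hx : x ∈ antiSkew θ m) :
    x * wMat E m * T ∈ lieAlg θ T := by
  change conjT θ (wMat E m * x) = -(wMat E m * x) at hx
  change conjT θ (x * wMat E m * T) * T + T * (x * wMat E m * T) = 0
  rw [conjT_mul, conjT_wMat] at hx
  have hx2 : conjT θ x = -(wMat E m * x * wMat E m) := by
    rw [← neg_mul, ← hx, Matrix.mul_assoc, wMat_mul_wMat, Matrix.mul_one]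
  rw [conjT_mul, conjT_mul, conjT_wMat, hT, hx2]
  have : wMat E m * -(wMat E m * x * wMat E m) = -(x * wMat E m) := by
    rw [mul_neg, ← Matrix.mul_assoc, ← Matrix.mul_assoc, wMat_mul_wMat, Matrix.one_mul]
  rw [this]
  simp only [mul_neg, neg_mul, Matrix.mul_assoc]
  exact neg_add_cancel _

lemma conjT_diagonal (hF : ∀ c : F, θ (algebraMap F E c) = algebraMap F E c) (d : Fin m → F) :
    conjT θ (Matrix.diagonal fun i => algebraMap F E (d i)) =
      Matrix.diagonal fun i => algebraMap F E (d i) := by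
  rw [conjT, Matrix.diagonal_map (map_zero θ), Matrix.diagonal_transpose]
  simp only [hF]

lemma map_omega {ω : E} {a : F} (hF : ∀ x : E, θ x = x ↔ x ∈ Set.range (algebraMap F E))
    (hω : ω ∉ Set.range (algebraMap F E)) (hωa : ω ^ 2 = algebraMap F E a) : θ ω = -ω := by
  have h : θ ω ^ 2 = ω ^ 2 := by rw [← map_pow, hωa, (hF _).2 ⟨a, rfl⟩]
  exact (sq_eq_sq_iff_eq_or_eq_neg.1 h).resolve_left fun h => hω ((hF ω).1 h)

end Unitary

/-! ### The measures -/

section Measures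

variable {E : Type*} [Field E] [TopologicalSpace E] {m : ℕ}

instance (θ : E ≃+* E) (T : Matrix (Fin m) (Fin m) E) : MeasurableSpace (unitaryGrp θ T) :=
  borel _

instance (θ : E ≃+* E) (T : Matrix (Fin m) (Fin m) E) : BorelSpace (unitaryGrp θ T) := ⟨rfl⟩

instance (θ : E ≃+* E) (T : Matrix (Fin m) (Fin m) E) : MeasurableSpace (lieAlg θ T) :=
  borel _

instance (θ : E ≃+* E) (T : Matrix (Fin m) (Fin m) E) : BorelSpace (lieAlg θ T) := ⟨rfl⟩

instance (θ : E ≃+* E) (m : ℕ) : MeasurableSpace (antiSkew θ m) := borel _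

instance (θ : E ≃+* E) (m : ℕ) : BorelSpace (antiSkew θ m) := ⟨rfl⟩

variable {F : Type*} [Field F] [ValuativeRel F] [TopologicalSpace F]
  [IsNonarchimedeanLocalField F] [MeasurableSpace F] [BorelSpace F]
  [ValuativeRel E] [IsNonarchimedeanLocalField E] [MeasurableSpace E] [BorelSpace E]
  [Algebra F E]

/-- The data of an involution `θ` of `E`, a generator `ω` and a diagonal hermitian matrix `T`: `θ` is an involution of `E`, `F` is its fixed field, `E = F ⊕ F ω` with `ω² = a`, and
`T = diag(d_1, …, d_m)` with nonzero entries in `F`. -/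
structure IsUnitaryData (θ : E ≃+* E) (ω : E) (a : F) (d : Fin m → F) : Prop where
  invol : ∀ x, θ (θ x) = x
  fixed : ∀ x, θ x = x ↔ x ∈ Set.range (algebraMap F E)
  omega_notMem : ω ∉ Set.range (algebraMap F E)
  omega_sq : ω ^ 2 = algebraMap F E a
  a_ne_zero : a ≠ 0
  d_ne_zero : ∀ i, d i ≠ 0

/-- The matrix `T = diag(d_1, …, d_m)`. -/
def diagT (E : Type*) [Field E] [Algebra F E] (d : Fin m → F) : Matrix (Fin m) (Fin m) E :=
  Matrix.diagonal fun i => algebraMap F E (d i)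

variable {θ : E ≃+* E} {ω : E} {a : F} {d : Fin m → F}

/-- The measure `dx = ∏_{i+j<m+1} dx_{ij} ∏_i dx^{(ω)}_i` on the matrices `x` with
`(w_m x)^* = -(w_m x)`: each `x_{ij}` with `i + j < m + 1` runs over `E` and each entry `t ω` on
the second diagonal runs over `F ω`, with the measures that give `𝒪_E`, respectively `𝒪_F ω`, the
measure `1`. -/
def dx (D : IsUnitaryData θ ω a d) : Measure (antiSkew θ m) :=
  ((Measure.pi fun _ : AbovePos m => haarO E).prod (Measure.pi fun _ : Fin m => haarO F)).map
    fun c => ⟨skewOfCoords θ ω c, skewOfCoords_mem θ D.invol (fun x => (D.fixed _).2 ⟨x, rfl⟩)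
      (map_omega θ D.fixed D.omega_notMem D.omega_sq) c⟩

/-- The measure `dμ(y) = dx` on `𝔤`, where `y = x w_m T`. -/
def mu (D : IsUnitaryData θ ω a d) : Measure (lieAlg θ (diagT E d)) :=
  (dx D).map fun x => ⟨x.1 * wMat E m * diagT E d,
    mul_wMat_mul_mem θ (conjT_diagonal θ (fun x => (D.fixed _).2 ⟨x, rfl⟩) d) x.2⟩

end Measures

end

end CayleyUnitary

open CayleyUnitary

namespace CayleyUnitary

open scoped Pointwise ENNReal Topology WithZero

noncomputable section

/-! ### Counting cosets -/

section Cosets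

variable {G : Type*} [Group G]

/-- A measure that gives the same mass to all left cosets of `H` in `K` satisfies
`μ K = [K : H] c`. -/
@[to_additive]
lemma _root_.Subgroup.measure_eq_card_of_cosets [MeasurableSpace G] (μ : Measure G) {H K : Subgroup G} (hHK : H ≤ K)
    [Countable (K ⧸ H.subgroupOf K)] {c : ℝ≥0∞} (hmeas : ∀ k : G, MeasurableSet (k • (H : Set G)))
    (hc : ∀ k ∈ K, μ (k • (H : Set G)) = c) :
    μ K = ENat.card (K ⧸ H.subgroupOf K) * c := by
  have hK : (K : Set G) = ⋃ q : K ⧸ H.subgroupOf K, (q.out : G) • (H : Set G) := by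
    ext x
    simp only [SetLike.mem_coe, Set.mem_iUnion]
    constructor
    · intro hx
      refine ⟨QuotientGroup.mk ⟨x, hx⟩, ?_⟩
      rw [mem_leftCoset_iff]
      have h := QuotientGroup.mk_out_eq_mul (H.subgroupOf K) ⟨x, hx⟩
      obtain ⟨h', hh'⟩ := h
      rw [hh']
      have := h'.2
      rw [Subgroup.mem_subgroupOf] at this
      simpa using H.inv_mem this
    · rintro ⟨q, hq⟩
      rw [mem_leftCoset_iff] at hq
      have := K.mul_mem q.out.2 (hHK hq)
      simpa using this
  rw [hK, measure_iUnion _ fun q => hmeas _, tsum_congr fun q => hc _ q.out.2, ENNReal.tsum_const]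
  intro q r hqr
  refine Set.disjoint_left.2 fun x hx hx' => hqr ?_
  rw [mem_leftCoset_iff] at hx hx'
  rw [← QuotientGroup.out_eq' q, ← QuotientGroup.out_eq' r, QuotientGroup.eq,
    Subgroup.mem_subgroupOf]
  have := H.mul_mem hx (H.inv_mem hx')
  simpa using this

end Cosets

/-! ### Topology of local fields -/

section LocalField

variable (K : Type*) [Field K] [ValuativeRel K] [TopologicalSpace K] [IsNonarchimedeanLocalField K]

instance : T2Space K := by
  refine IsTopologicalAddGroup.t2Space_of_zero_sep fun x hx => ?_
  refine ⟨{y | valuation K y < valuation K x},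
    (IsValuativeTopology.hasBasis_nhds_zero' K).mem_of_mem ?_, ?_⟩
  · simpa using hx
  · simp

instance : Countable (ValueGroupWithZero K) :=
  have : Countable ℤᵐ⁰ := inferInstanceAs (Countable (Option (Multiplicative ℤ)))
  (IsNonarchimedeanLocalField.valueGroupWithZeroIsoInt K).injective.countable

instance : SigmaCompactSpace K := by
  refine SigmaCompactSpace.of_countable (Set.range fun γ => {x | valuation K x ≤ γ})
    (Set.countable_range _) ?_ ?_
  · rintro _ ⟨γ, rfl⟩
    exact IsNonarchimedeanLocalField.isCompact_closedBall K γ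
  · refine Set.eq_univ_of_forall fun x => ⟨_, ⟨valuation K x, rfl⟩, ?_⟩
    simp

instance : SecondCountableTopology K := by
  let := IsTopologicalAddGroup.rightUniformSpace K
  have := isUniformAddGroup_of_addCommGroup (G := K)
  have : (𝓝 (0 : K)).IsCountablyGenerated :=
    Filter.HasCountableBasis.isCountablyGenerated
      ⟨IsValuativeTopology.hasBasis_nhds_zero' K, Set.to_countable _⟩
  have := IsUniformAddGroup.uniformity_countably_generated (α := K)
  let := UniformSpace.pseudoMetricSpace K
  exact EMetric.secondCountable_of_sigmaCompact K

lemma isOpen_valuation_lt {γ : ValueGroupWithZero K} (hγ : γ ≠ 0) :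
    IsOpen {x : K | valuation K x < γ} :=
  AddSubgroup.isOpen_of_mem_nhds ((valuation K).ltAddSubgroup (Units.mk0 γ hγ)) (g := 0)
    ((IsValuativeTopology.hasBasis_nhds_zero' K).mem_of_mem hγ)

/-! ### The module of a local field -/

instance [MeasurableSpace K] [BorelSpace K] : (haarO K).IsAddHaarMeasure := by
  unfold haarO; infer_instance

instance [MeasurableSpace K] [BorelSpace K] : (haarO K).Regular := by
  unfold haarO; infer_instance

variable {K}

lemma absVal_mul (x y : K) : absVal (x * y) = absVal x * absVal y := by simp [absVal]

lemma absVal_one : absVal (1 : K) = 1 := by simp [absVal]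

lemma absVal_nonneg (x : K) : 0 ≤ absVal x := by simp [absVal]

lemma absVal_pos {x : K} (hx : x ≠ 0) : 0 < absVal x :=
  NNReal.coe_pos.2 <| WithZeroMulInt.toNNReal_pos _ (by simpa using hx)

lemma absVal_eq_of_valuation_eq {x y : K} (h : valuation K x = valuation K y) :
    absVal x = absVal y := by simp [absVal, h]

lemma exists_uniformizer : ∃ ϖ : K, IsNonarchimedeanLocalField.valueGroupWithZeroIsoInt K
    (valuation K ϖ) = WithZero.exp (-1) := by
  obtain ⟨x, hx⟩ := valuation_surjective
    ((IsNonarchimedeanLocalField.valueGroupWithZeroIsoInt K).symm (WithZero.exp (-1)))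
  exact ⟨x, by rw [hx, OrderMonoidIso.apply_symm_apply]⟩

lemma absVal_uniformizer {ϖ : K} (h : IsNonarchimedeanLocalField.valueGroupWithZeroIsoInt K
    (valuation K ϖ) = WithZero.exp (-1)) : absVal ϖ = (residueCard K : ℝ)⁻¹ := by
  rw [absVal, h, WithZeroMulInt.toNNReal_neg_apply _ (by simp)]
  change ((residueCard K ^ (-1 : ℤ) : ℝ≥0) : ℝ) = _
  simp

lemma valuation_le_uniformizer {ϖ : K} (h : IsNonarchimedeanLocalField.valueGroupWithZeroIsoInt K
    (valuation K ϖ) = WithZero.exp (-1)) (x : K) :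
    valuation K x ≤ valuation K ϖ ↔ valuation K x < 1 := by
  set e := IsNonarchimedeanLocalField.valueGroupWithZeroIsoInt K
  have h1 : valuation K x < 1 ↔ e (valuation K x) < 1 := by
    rw [← map_one e]; exact e.strictMono.lt_iff_lt.symm
  rw [← e.strictMono.le_iff_le, h1, h]
  generalize e (valuation K x) = y
  induction y using WithZero.expRecOn with
  | zero => simp
  | exp n =>
    rw [WithZero.exp_le_exp, ← WithZero.exp_zero, WithZero.exp_lt_exp]
    omega

omit [TopologicalSpace K] [IsNonarchimedeanLocalField K] in
lemma smul_closedBall (a : Kˣ) :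
    a • {x : K | valuation K x ≤ 1} = {x | valuation K x ≤ valuation K a} := by
  ext x
  have ha : valuation K (a : K) ≠ 0 := by simp
  rw [Set.mem_smul_set_iff_inv_smul_mem]
  simp only [Set.mem_ofPred_eq, Units.smul_def, smul_eq_mul, map_mul, Units.val_inv_eq_inv_val,
    map_inv₀]
  rw [inv_mul_le_one₀ (zero_lt_iff.2 ha)]

variable (K) in
/-- The ring of integers as an additive subgroup. -/
abbrev integersAddSubgroup : AddSubgroup K := 𝒪[K].toAddSubgroup

lemma card_integers_quotient :
    ENat.card (integersAddSubgroup K ⧸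
      ((valuation K).ltAddSubgroup 1).addSubgroupOf (integersAddSubgroup K)) =
      (Nat.card 𝓀[K] : ℕ∞) := by
  let f : 𝒪[K] →+ 𝓀[K] := (IsLocalRing.residue 𝒪[K]).toAddMonoidHom
  have hf : Function.Surjective f := IsLocalRing.residue_surjective
  have hker : f.ker = ((valuation K).ltAddSubgroup 1).addSubgroupOf (integersAddSubgroup K) := by
    ext x
    change IsLocalRing.residue 𝒪[K] x = 0 ↔ valuation K x.1 < ((1 : (ValueGroupWithZero K)ˣ) : _)
    rw [IsLocalRing.residue_eq_zero_iff, Units.val_one, IsLocalRing.mem_maximalIdeal,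
      mem_nonunits_iff, Valuation.Integer.not_isUnit_iff_valuation_lt_one]
  rw [← ENat.card_eq_coe_natCard]
  exact ENat.card_congr <| (QuotientAddGroup.quotientAddEquivOfEq hker.symm).toEquiv.trans
    (QuotientAddGroup.quotientKerEquivOfSurjective f hf).toEquiv

variable [MeasurableSpace K] [BorelSpace K]

lemma haarO_closedBall : haarO K {x | valuation K x ≤ 1} = 1 :=
  Measure.addHaarMeasure_self (K₀ := integersCompacts K)

lemma card_mul_haarO_ball :
    (Nat.card 𝓀[K] : ℝ≥0∞) * haarO K {x | valuation K x < 1} = 1 := by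
  have hfin : Finite (integersAddSubgroup K ⧸
      ((valuation K).ltAddSubgroup 1).addSubgroupOf (integersAddSubgroup K)) := by
    rw [← ENat.card_lt_top, card_integers_quotient]
    exact ENat.natCast_lt_top _
  have hH : (((valuation K).ltAddSubgroup 1 : AddSubgroup K) : Set K) =
    {x | valuation K x < 1} := rfl
  have := AddSubgroup.measure_eq_card_of_cosets (haarO K) (H := (valuation K).ltAddSubgroup 1)
    (K := integersAddSubgroup K) (fun x (hx : valuation K x < 1) => hx.le)
    (c := haarO K {x | valuation K x < 1}) (fun k => by
      rw [hH]
      exact ((isOpen_valuation_lt K one_ne_zero).vadd k).measurableSet) (fun k _ => by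
      rw [hH, measure_vadd])
  rw [card_integers_quotient] at this
  rw [← haarO_closedBall (K := K)]
  exact_mod_cast this.symm

/-- The factor by which multiplication by `a` scales the Haar measures of `K` is `|a|_K`. -/
lemma distribHaarChar_eq_absVal (a : Kˣ) : (distribHaarChar K a : ℝ) = absVal (a : K) := by
  have hO : haarO K {x | valuation K x ≤ 1} ≠ 0 := by simp [haarO_closedBall]
  have hO' : haarO K {x | valuation K x ≤ 1} ≠ ∞ := by simp [haarO_closedBall]
  have hunit : ∀ u : Kˣ, valuation K (u : K) = 1 → distribHaarChar K u = 1 := fun u hu =>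
    distribHaarChar_eq_of_measure_smul_eq_mul hO hO' (by rw [smul_closedBall, hu]; simp)
  obtain ⟨ϖ, hϖ⟩ := exists_uniformizer (K := K)
  have hϖ0 : ϖ ≠ 0 := by rintro rfl; simp [WithZero.exp_ne_zero.symm] at hϖ
  have hunif : distribHaarChar K (Units.mk0 ϖ hϖ0) = (residueCard K)⁻¹ := by
    refine distribHaarChar_eq_of_measure_smul_eq_mul hO hO' ?_
    rw [smul_closedBall, haarO_closedBall, mul_one]
    simp only [Units.val_mk0, valuation_le_uniformizer hϖ]
    have h := card_mul_haarO_ball (K := K)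
    rw [ENNReal.coe_inv (residueCard_ne_zero K)]
    exact ENNReal.eq_inv_of_mul_eq_one_left (by rw [mul_comm]; exact_mod_cast h)
  obtain ⟨n, hn⟩ : ∃ n : ℤ, valuation K (a : K) = valuation K ϖ ^ n := by
    set e := IsNonarchimedeanLocalField.valueGroupWithZeroIsoInt K with he
    have ha : e (valuation K (a : K)) ≠ 0 := by simp
    refine ⟨-(WithZero.log (e (valuation K (a : K)))), e.injective ?_⟩
    change e _ = e _
    rw [map_zpow₀, hϖ, ← WithZero.exp_zsmul]
    simp [WithZero.exp_log ha]
  have h1 : distribHaarChar K (a * (Units.mk0 ϖ hϖ0 ^ n)⁻¹) = 1 := hunit _ (by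
    simp only [Units.val_mul, Units.val_inv_eq_inv_val, Units.val_zpow_eq_zpow_val, Units.val_mk0,
      map_mul, map_inv₀, map_zpow₀, hn]
    exact mul_inv_cancel₀ (zpow_ne_zero _ (by simpa using hϖ0)))
  have h2 : absVal (a : K) = absVal (ϖ ^ n) := absVal_eq_of_valuation_eq (by simpa using hn)
  rw [map_mul, map_inv, map_zpow, hunif] at h1
  rw [h2, eq_of_mul_inv_eq_one h1]
  have := absVal_uniformizer hϖ
  simp only [absVal, map_zpow₀, NNReal.coe_zpow] at this ⊢
  rw [this]
  simp

end LocalField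

/-! ### Functoriality of the module character -/

section DistribHaarChar

variable {A B G H : Type*} [Group G] [Group H]
  [AddCommGroup A] [DistribMulAction G A] [TopologicalSpace A]
  [IsTopologicalAddGroup A] [LocallyCompactSpace A] [ContinuousConstSMul G A]
  [AddCommGroup B] [TopologicalSpace B] [IsTopologicalAddGroup B] [LocallyCompactSpace B]

/-- Automorphisms that correspond to each other under an isomorphism have the same module. -/
lemma distribHaarChar_congr [DistribMulAction H B] [ContinuousConstSMul H B] (φ : A ≃ₜ+ B)
    {g : G} {h : H} (hφ : ∀ x, φ (g • x) = h • φ x) :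
    distribHaarChar A g = distribHaarChar B h := by
  borelize A
  borelize B
  obtain ⟨K, hK, hK0⟩ := exists_compact_mem_nhds (0 : A)
  have h0 : Measure.addHaar K ≠ 0 :=
    (Measure.measure_pos_of_mem_nhds Measure.addHaar hK0).ne'
  let e : A ≃ᵐ B := φ.toHomeomorph.toMeasurableEquiv
  let ν : Measure B := Measure.addHaar.map φ
  have : ν.IsAddHaarMeasure := φ.isAddHaarMeasure_map _
  have : ν.Regular := Measure.Regular.map φ.toHomeomorph
  have hν : ∀ s : Set A, ν (φ '' s) = Measure.addHaar s := fun s => by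
    have := e.map_apply (μ := Measure.addHaar) (φ '' s)
    rw [show (e : A → B) = φ from rfl] at this
    rw [this, Set.preimage_image_eq _ φ.injective]
  symm
  refine distribHaarChar_eq_of_measure_smul_eq_mul (μ := ν) (s := φ '' K) ?_ ?_ ?_
  · rwa [hν]
  · rw [hν]; exact hK.measure_lt_top.ne
  · have : h • φ '' K = φ '' (g • K) := by
      simp only [← Set.image_smul, Set.image_image, hφ]
    rw [this, hν, hν, distribHaarChar_mul]

lemma distribHaarChar_prod [SecondCountableTopology A] [SecondCountableTopology B]
    [DistribMulAction G B] [ContinuousConstSMul G B] (g : G) :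
    distribHaarChar (A × B) g = distribHaarChar A g * distribHaarChar B g := by
  borelize A
  borelize B
  obtain ⟨K, hK, hK0⟩ := exists_compact_mem_nhds (0 : A)
  obtain ⟨L, hL, hL0⟩ := exists_compact_mem_nhds (0 : B)
  have hKp := (Measure.measure_pos_of_mem_nhds (Measure.addHaar : Measure A) hK0).ne'
  have hLp := (Measure.measure_pos_of_mem_nhds (Measure.addHaar : Measure B) hL0).ne'
  let ν : Measure (A × B) := Measure.addHaar.prod Measure.addHaar
  have : ν.Regular := by
    rw [Measure.isAddLeftInvariant_eq_smul ν Measure.addHaar]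
    infer_instance
  refine distribHaarChar_eq_of_measure_smul_eq_mul (μ := ν) (s := K ×ˢ L) ?_ ?_ ?_
  · simp [ν, Measure.prod_prod, hKp, hLp]
  · rw [Measure.prod_prod]
    exact ENNReal.mul_ne_top hK.measure_lt_top.ne hL.measure_lt_top.ne
  · have : g • (K ×ˢ L) = (g • K) ×ˢ (g • L) := Set.smul_set_prod g K L
    rw [this, Measure.prod_prod, Measure.prod_prod, ← distribHaarChar_mul, ← distribHaarChar_mul]
    push_cast
    ring

lemma distribHaarChar_pi [SecondCountableTopology A] {ι : Type*} [Fintype ι] (g : G) :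
    distribHaarChar (ι → A) g = distribHaarChar A g ^ Fintype.card ι := by
  borelize A
  obtain ⟨K, hK, hK0⟩ := exists_compact_mem_nhds (0 : A)
  have hKp := (Measure.measure_pos_of_mem_nhds (Measure.addHaar : Measure A) hK0).ne'
  let ν : Measure (ι → A) := Measure.pi fun _ => Measure.addHaar
  have : ν.Regular := by
    rw [Measure.isAddLeftInvariant_eq_smul ν Measure.addHaar]
    infer_instance
  refine distribHaarChar_eq_of_measure_smul_eq_mul (μ := ν) (s := Set.univ.pi fun _ => K) ?_ ?_ ?_
  · rw [Measure.pi_pi]; simp [hKp, Finset.prod_const]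
  · rw [Measure.pi_pi]
    exact ENNReal.prod_ne_top fun _ _ => hK.measure_lt_top.ne
  · have : g • (Set.univ.pi fun _ : ι => K) = Set.univ.pi fun _ => g • K :=
      Set.smul_set_univ_pi g _
    rw [this, Measure.pi_pi, Measure.pi_pi]
    simp_rw [← distribHaarChar_mul]
    rw [Finset.prod_mul_distrib]
    simp

end DistribHaarChar

/-! ### Quadratic extensions -/

section Quadratic

variable {F E : Type*}
  [Field F] [ValuativeRel F] [TopologicalSpace F] [IsNonarchimedeanLocalField F]
  [Field E] [ValuativeRel E] [TopologicalSpace E] [IsNonarchimedeanLocalField E]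
  [Algebra F E]

lemma continuous_algebraMap_of_valuativeExtension [ValuativeExtension F E] :
    Continuous (algebraMap F E) := by
  refine continuous_of_continuousAt_zero _ ?_
  rw [ContinuousAt, map_zero, (IsValuativeTopology.hasBasis_nhds_zero' F).tendsto_iff
    (IsValuativeTopology.hasBasis_nhds_zero' E)]
  intro γ hγ
  obtain ⟨ϖ, hϖ0, hϖ⟩ := Valuation.IsNontrivial.exists_lt_one (v := valuation F)
  have h1 : valuation E (algebraMap F E ϖ) < 1 := by
    rw [← ValuativeExtension.mapValueGroupWithZero_valuation,
      ← map_one (ValuativeExtension.mapValueGroupWithZero F E)]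
    exact ValuativeExtension.mapValueGroupWithZero_strictMono hϖ
  obtain ⟨n, hn⟩ := exists_pow_lt₀ h1 (Units.mk0 γ hγ)
  refine ⟨valuation F ϖ ^ n, pow_ne_zero _ (by simpa using hϖ0), fun x hx => ?_⟩
  simp only [Set.mem_ofPred_eq] at hx ⊢
  refine lt_trans ?_ hn
  have := ValuativeExtension.mapValueGroupWithZero_strictMono (A := F) (B := E) hx
  simpa using this

variable {m : ℕ} {θ : E ≃+* E} {ω : E} {a : F} {d : Fin m → F}

namespace IsUnitaryData

omit [ValuativeRel F] [TopologicalSpace F] [IsNonarchimedeanLocalField F]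
  [ValuativeRel E] [TopologicalSpace E] [IsNonarchimedeanLocalField E] in
lemma map_algebraMap (D : IsUnitaryData θ ω a d) (c : F) :
    θ (algebraMap F E c) = algebraMap F E c := (D.fixed _).2 ⟨c, rfl⟩

omit [ValuativeRel F] [TopologicalSpace F] [IsNonarchimedeanLocalField F]
  [ValuativeRel E] [TopologicalSpace E] [IsNonarchimedeanLocalField E] in
lemma theta_omega (D : IsUnitaryData θ ω a d) : θ ω = -ω :=
  map_omega θ D.fixed D.omega_notMem D.omega_sq

omit [ValuativeRel F] [TopologicalSpace F] [IsNonarchimedeanLocalField F]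
  [ValuativeRel E] [TopologicalSpace E] [IsNonarchimedeanLocalField E] in
lemma omega_ne_zero (D : IsUnitaryData θ ω a d) : ω ≠ 0 := by
  rintro rfl
  exact D.omega_notMem ⟨0, map_zero _⟩

omit [ValuativeRel F] [TopologicalSpace F] [IsNonarchimedeanLocalField F]
  [ValuativeRel E] [TopologicalSpace E] [IsNonarchimedeanLocalField E] in
lemma exists_eq_mul_omega (D : IsUnitaryData θ ω a d) {x : E} (hx : θ x = -x) :
    ∃ t : F, algebraMap F E t * ω = x := by
  obtain ⟨t, ht⟩ := (D.fixed (x / ω)).1 (by rw [map_div₀, hx, D.theta_omega, neg_div_neg_eq])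
  exact ⟨t, by rw [ht, div_mul_cancel₀ _ D.omega_ne_zero]⟩

variable [CharZero E]

omit [ValuativeRel F] [TopologicalSpace F] [IsNonarchimedeanLocalField F]
  [ValuativeRel E] [TopologicalSpace E] [IsNonarchimedeanLocalField E] in
lemma exists_add_mul_omega (D : IsUnitaryData θ ω a d) (x : E) :
    ∃ s t : F, algebraMap F E s + algebraMap F E t * ω = x := by
  obtain ⟨s, hs⟩ := (D.fixed ((x + θ x) / 2)).1 (by
    rw [map_div₀, map_add, D.invol, map_ofNat, add_comm])
  obtain ⟨t, ht⟩ := D.exists_eq_mul_omega (x := (x - θ x) / 2) (by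
    rw [map_div₀, map_sub, D.invol, map_ofNat]; ring)
  exact ⟨s, t, by rw [hs, ht]; ring⟩

omit [ValuativeRel F] [TopologicalSpace F] [IsNonarchimedeanLocalField F]
  [ValuativeRel E] [TopologicalSpace E] [IsNonarchimedeanLocalField E] in
lemma add_mul_omega_eq_zero (D : IsUnitaryData θ ω a d) {s t : F}
    (h : algebraMap F E s + algebraMap F E t * ω = 0) : s = 0 ∧ t = 0 := by
  have h' := congrArg θ h
  rw [map_add, map_mul, D.map_algebraMap, D.map_algebraMap, D.theta_omega, map_zero] at h'
  have hs : (2 : E) * algebraMap F E s = 0 := by linear_combination h + h'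
  have hs : algebraMap F E s = 0 := by simpa using hs
  rw [hs, zero_add, mul_eq_zero, or_iff_left D.omega_ne_zero] at h
  exact ⟨by simpa using hs, by simpa using h⟩

variable [ValuativeExtension F E]

/-- The topological isomorphism `F × F ≃ E`, `(s, t) ↦ s + t ω`. -/
def quadEquiv (D : IsUnitaryData θ ω a d) : (F × F) ≃ₜ+ E :=
  let f : F × F →+ E :=
    { toFun := fun p => algebraMap F E p.1 + algebraMap F E p.2 * ω
      map_zero' := by simp
      map_add' := fun p q => by simp only [Prod.fst_add, Prod.snd_add, map_add]; ring }
  have hbij : Function.Bijective f :=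
    ⟨(injective_iff_map_eq_zero f).2 fun p hp =>
      Prod.ext (D.add_mul_omega_eq_zero hp).1 (D.add_mul_omega_eq_zero hp).2,
      fun x => let ⟨s, t, h⟩ := D.exists_add_mul_omega x; ⟨(s, t), h⟩⟩
  have hcont : Continuous f := by
    have := continuous_algebraMap_of_valuativeExtension (F := F) (E := E)
    change Continuous fun p : F × F => algebraMap F E p.1 + algebraMap F E p.2 * ω
    fun_prop
  { AddEquiv.ofBijective f hbij with
    continuous_toFun := hcont
    continuous_invFun := by
      have ho : IsOpenMap f := AddMonoidHom.isOpenMap_of_sigmaCompact f hbij.2 hcont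
      exact ((Equiv.ofBijective f hbij).toHomeomorphOfContinuousOpen hcont ho).symm.continuous }

lemma quadEquiv_apply (D : IsUnitaryData θ ω a d) (p : F × F) :
    D.quadEquiv p = algebraMap F E p.1 + algebraMap F E p.2 * ω := rfl

lemma continuous_theta (D : IsUnitaryData θ ω a d) : Continuous θ := by
  have h : θ = fun x => D.quadEquiv ((D.quadEquiv.symm x).1, -(D.quadEquiv.symm x).2) := by
    funext x
    obtain ⟨p, rfl⟩ := D.quadEquiv.surjective x
    rw [ContinuousAddEquiv.symm_apply_apply]
    simp [quadEquiv_apply, D.map_algebraMap, D.theta_omega]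
  rw [h]
  fun_prop

/-- `θ` as an automorphism of the topological group `E`. -/
def thetaEquiv (D : IsUnitaryData θ ω a d) : E ≃ₜ+ E :=
  { θ.toAddEquiv with
    continuous_toFun := D.continuous_theta
    continuous_invFun := by
      have : (θ.symm : E → E) = θ := by
        funext x
        rw [RingEquiv.symm_apply_eq, D.invol]
      change Continuous θ.symm
      rw [this]
      exact D.continuous_theta }

lemma distribHaarChar_theta (D : IsUnitaryData θ ω a d) (x : Eˣ) :
    distribHaarChar E (Units.map θ.toMonoidHom x) = distribHaarChar E x :=
  (distribHaarChar_congr D.thetaEquiv fun y => by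
    simp [Units.smul_def, thetaEquiv]).symm

lemma absVal_theta (D : IsUnitaryData θ ω a d) (x : E) : absVal (θ x) = absVal x := by
  borelize E
  by_cases hx : x = 0
  · simp [hx]
  · have := D.distribHaarChar_theta (Units.mk0 x hx)
    rw [← NNReal.coe_inj, distribHaarChar_eq_absVal, distribHaarChar_eq_absVal] at this
    exact this

lemma distribHaarChar_algebraMap (D : IsUnitaryData θ ω a d) (c : Fˣ) :
    distribHaarChar E (Units.map (algebraMap F E).toMonoidHom c) = distribHaarChar F c ^ 2 := by
  rw [sq, ← distribHaarChar_prod]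
  refine (distribHaarChar_congr D.quadEquiv fun y => ?_).symm
  simp only [quadEquiv_apply, Units.smul_def, Prod.smul_fst, Prod.smul_snd, smul_eq_mul, map_mul,
    Units.coe_map]
  change _ = algebraMap F E c * _
  ring

lemma distribHaarChar_norm (D : IsUnitaryData θ ω a d) {c : Fˣ} {x : Eˣ}
    (h : algebraMap F E c = x * θ x) : distribHaarChar F c = distribHaarChar E x := by
  have h1 : Units.map (algebraMap F E).toMonoidHom c = x * Units.map θ.toMonoidHom x :=
    Units.ext h
  have h2 := D.distribHaarChar_algebraMap c
  rw [h1, map_mul, D.distribHaarChar_theta, ← sq] at h2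
  exact (pow_left_injective two_ne_zero h2).symm

omit [ValuativeRel F] [TopologicalSpace F] [IsNonarchimedeanLocalField F]
  [ValuativeRel E] [TopologicalSpace E] [IsNonarchimedeanLocalField E] [CharZero E]
  [ValuativeExtension F E] in
lemma exists_norm (D : IsUnitaryData θ ω a d) (x : Eˣ) :
    ∃ c : Fˣ, algebraMap F E c = x * θ x := by
  obtain ⟨c, hc⟩ := (D.fixed (x * θ x)).1 (by rw [map_mul, D.invol, mul_comm])
  have h0 : c ≠ 0 := by
    rintro rfl
    simp at hc
  exact ⟨Units.mk0 c h0, hc⟩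

end IsUnitaryData

end Quadratic

/-! ### Homomorphisms from the general linear group to a commutative monoid -/

section GLHom

variable {E : Type*} [Field E] [CharZero E] {m : ℕ}

/-- Diagonal matrices with invertible entries. -/
def diagGL : (Fin m → Eˣ) →* GL (Fin m) E :=
  (Units.map (Matrix.diagonalRingHom (Fin m) E).toMonoidHom).comp
    (MulEquiv.piUnits (M := fun _ : Fin m => E)).symm.toMonoidHom

omit [CharZero E] in
lemma coe_diagGL (a : Fin m → Eˣ) :
    (diagGL a : Matrix (Fin m) (Fin m) E) = Matrix.diagonal fun i => (a i : E) := rfl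

/-- The scalar matrix `a I`. -/
def scalarGL : Eˣ →* GL (Fin m) E := diagGL.comp (Pi.constMonoidHom (Fin m) Eˣ)

omit [CharZero E] in
lemma coe_scalarGL (a : Eˣ) :
    ((scalarGL a : GL (Fin m) E) : Matrix (Fin m) (Fin m) E) = Matrix.diagonal fun _ => (a : E) := rfl

omit [CharZero E] in
lemma map_eq_of_semiconj (χ : GL (Fin m) E →* ℝ≥0) {x y z : GL (Fin m) E}
    (h : x * y = z * x) : χ y = χ z := by
  have h1 := congrArg χ h
  rw [map_mul, map_mul, mul_comm] at h1
  exact mul_right_cancel₀ ((Group.isUnit x).map χ).ne_zero h1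

omit [CharZero E] in
lemma map_diagGL_comp_perm (χ : GL (Fin m) E →* ℝ≥0) (a : Fin m → Eˣ)
    (σ : Equiv.Perm (Fin m)) : χ (diagGL (a ∘ σ)) = χ (diagGL a) := by
  have hP : IsUnit (σ.permMatrix E) := by
    rw [Matrix.isUnit_iff_isUnit_det, Matrix.det_permutation]
    exact (Int.isUnit_iff.2 (Int.units_eq_one_or σ.sign |>.imp (by simp +contextual)
      (by simp +contextual))).map (Int.castRingHom E)
  refine (map_eq_of_semiconj χ (x := hP.unit) (Units.ext ?_)).symm
  rw [Units.val_mul, Units.val_mul, IsUnit.unit_spec, coe_diagGL, coe_diagGL]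
  ext i j
  rw [Matrix.mul_diagonal, Matrix.diagonal_mul, Equiv.Perm.permMatrix, PEquiv.toMatrix_apply]
  by_cases h : σ i = j <;> simp [h]

omit [CharZero E] in
lemma map_diagGL_pow (χ : GL (Fin m) E →* ℝ≥0) (a : Fin m → Eˣ) :
    χ (diagGL a) ^ m = χ (scalarGL (∏ i, a i)) := by
  rcases Nat.eq_zero_or_pos m with rfl | hm
  · simp [Subsingleton.elim (scalarGL _ : GL (Fin 0) E) 1]
  · have : NeZero m := ⟨hm.ne'⟩
    calc χ (diagGL a) ^ m = ∏ k : Fin m, χ (diagGL (a ∘ Equiv.addRight k)) := by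
          simp only [map_diagGL_comp_perm, Finset.prod_const, Finset.card_univ, Fintype.card_fin]
      _ = χ (diagGL (∏ k : Fin m, a ∘ Equiv.addRight k)) := (map_prod (χ.comp diagGL) _ _).symm
      _ = χ (scalarGL (∏ i, a i)) := by
          change χ (diagGL _) = χ (diagGL _)
          congr 2
          funext i
          rw [Finset.prod_apply]
          exact Equiv.prod_comp (Equiv.addLeft i) a

/-- A homomorphism from `GL_m(E)` to a commutative monoid factors, up to `m`-th powers, through the
determinant followed by the inclusion of the scalar matrices. -/
lemma map_pow_eq_map_scalar_det (χ : GL (Fin m) E →* ℝ≥0) (A : GL (Fin m) E) :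
    χ A ^ m = χ (scalarGL (Matrix.GeneralLinearGroup.det A)) := by
  refine Matrix.diagonal_transvection_induction_of_det_ne_zero
    (fun M => ∀ A : GL (Fin m) E, A.1 = M →
      χ A ^ m = χ (scalarGL (Matrix.GeneralLinearGroup.det A))) A.1
    (Matrix.GeneralLinearGroup.det A).ne_zero ?_ ?_ ?_ A rfl
  · intro D hD A hA
    rw [Matrix.det_diagonal, Finset.prod_ne_zero_iff] at hD
    have h : A = diagGL fun i => Units.mk0 (D i) (hD i (Finset.mem_univ _)) :=
      Units.ext (by rw [hA, coe_diagGL]; rfl)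
    rw [h, map_diagGL_pow]
    congr 2
    ext
    simp [coe_diagGL]
  · intro t A hA
    have hdet : Matrix.GeneralLinearGroup.det A = 1 := Units.ext (by simp [hA])
    have h2 : ((2 : E)) ≠ 0 := two_ne_zero
    have hconj : diagGL (Function.update 1 t.i (Units.mk0 2 h2)) * A =
        (A * A) * diagGL (Function.update 1 t.i (Units.mk0 2 h2)) := by
      refine Units.ext ?_
      have hcoe : ∀ k, ((Function.update (1 : Fin m → Eˣ) t.i (Units.mk0 2 h2) k : Eˣ) : E) =
          if k = t.i then 2 else 1 := by
        intro k
        by_cases hk : k = t.i <;> simp [hk]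
      rw [Units.val_mul, Units.val_mul, Units.val_mul, hA, coe_diagGL, Matrix.TransvectionStruct.toMatrix,
        Matrix.transvection_mul_transvection_same _ _ t.hij]
      ext k l
      rw [Matrix.diagonal_mul, Matrix.mul_diagonal, hcoe, hcoe]
      simp only [Matrix.transvection, Matrix.add_apply, Matrix.one_apply, Matrix.single_apply]
      have := t.hij
      by_cases hk : k = t.i <;> by_cases hl : l = t.j <;> by_cases hkl : k = l <;>
        simp_all <;> grind
    have h1 := map_eq_of_semiconj χ hconj
    rw [map_mul] at h1
    have h3 : χ A = 1 :=
      (mul_eq_left₀ ((Group.isUnit A).map χ).ne_zero).1 h1.symm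
    rw [h3, hdet]
    simp
  · intro M N hM hN ihM ihN A hA
    let A₁ := Matrix.GeneralLinearGroup.mkOfDetNeZero M hM
    let A₂ := Matrix.GeneralLinearGroup.mkOfDetNeZero N hN
    have h : A = A₁ * A₂ := Units.ext hA
    rw [h, map_mul, mul_pow, ihM A₁ rfl, ihN A₂ rfl, map_mul, map_mul, map_mul]

end GLHom

/-! ### The adjoint with respect to `T` -/

section Adjoint

variable {F E : Type*} [Field F] [Field E] [Algebra F E]
  {m : ℕ} {θ : E ≃+* E} {ω : E} {a : F} {d : Fin m → F}

/-- The adjoint `T⁻¹ x^* T` of `x`. -/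
def adj (θ : E ≃+* E) (d : Fin m → F) (x : Matrix (Fin m) (Fin m) E) : Matrix (Fin m) (Fin m) E :=
  diagT E d⁻¹ * conjT θ x * diagT E d

lemma adj_apply (x : Matrix (Fin m) (Fin m) E) (i j : Fin m) :
    adj θ d x i j = (algebraMap F E (d i))⁻¹ * θ (x j i) * algebraMap F E (d j) := by
  simp [adj, diagT, conjT, Matrix.mul_diagonal, Matrix.diagonal_mul]

lemma adj_add (x y : Matrix (Fin m) (Fin m) E) : adj θ d (x + y) = adj θ d x + adj θ d y := by
  simp only [adj, conjT_add, mul_add, add_mul]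

lemma adj_sub (x y : Matrix (Fin m) (Fin m) E) : adj θ d (x - y) = adj θ d x - adj θ d y := by
  simp only [adj, conjT_sub, mul_sub, sub_mul]

lemma mem_lieAlg_iff (x : Matrix (Fin m) (Fin m) E) : x ∈ lieAlg θ (diagT E d) ↔
    ∀ i j, θ (x j i) * algebraMap F E (d j) + algebraMap F E (d i) * x i j = 0 := by
  change conjT θ x * diagT E d + diagT E d * x = 0 ↔ _
  rw [← Matrix.ext_iff]
  simp [diagT, conjT, Matrix.mul_diagonal, Matrix.diagonal_mul]

namespace IsUnitaryData

lemma diagT_mul_inv (D : IsUnitaryData θ ω a d) :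
    diagT E d * diagT E d⁻¹ = (1 : Matrix (Fin m) (Fin m) E) := by
  simp [diagT, Matrix.diagonal_mul_diagonal, D.d_ne_zero]

lemma diagT_inv_mul (D : IsUnitaryData θ ω a d) :
    diagT E d⁻¹ * diagT E d = (1 : Matrix (Fin m) (Fin m) E) := by
  simp [diagT, Matrix.diagonal_mul_diagonal, D.d_ne_zero]

lemma algebraMap_d_ne_zero (D : IsUnitaryData θ ω a d) (i : Fin m) : algebraMap F E (d i) ≠ 0 := by
  simpa using D.d_ne_zero i

lemma adj_one (D : IsUnitaryData θ ω a d) : adj θ d (1 : Matrix (Fin m) (Fin m) E) = 1 := by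
  rw [adj, conjT_one, mul_one, D.diagT_inv_mul]

lemma adj_mul (D : IsUnitaryData θ ω a d) (x y : Matrix (Fin m) (Fin m) E) :
    adj θ d (x * y) = adj θ d y * adj θ d x := by
  calc adj θ d (x * y) = diagT E d⁻¹ * conjT θ y * 1 * conjT θ x * diagT E d := by
        rw [adj, conjT_mul]; simp only [mul_one, mul_assoc]
    _ = adj θ d y * adj θ d x := by
        rw [← D.diagT_mul_inv]; simp only [adj, mul_assoc]

lemma adj_adj (D : IsUnitaryData θ ω a d) (x : Matrix (Fin m) (Fin m) E) :
    adj θ d (adj θ d x) = x := by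
  ext i j
  simp only [adj_apply, map_mul, map_inv₀, D.invol, D.map_algebraMap]
  field_simp [D.algebraMap_d_ne_zero i, D.algebraMap_d_ne_zero j]

lemma det_adj (D : IsUnitaryData θ ω a d) (x : Matrix (Fin m) (Fin m) E) :
    (adj θ d x).det = θ x.det := by
  have h := congrArg Matrix.det D.diagT_inv_mul
  rw [Matrix.det_mul, Matrix.det_one] at h
  rw [adj, Matrix.det_mul, Matrix.det_mul, mul_right_comm, h, one_mul, conjT, Matrix.det_transpose]
  exact (RingHom.map_det θ.toRingHom x).symm

lemma mem_lieAlg_iff_adj (D : IsUnitaryData θ ω a d) {x : Matrix (Fin m) (Fin m) E} :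
    x ∈ lieAlg θ (diagT E d) ↔ adj θ d x = -x := by
  rw [mem_lieAlg_iff, ← Matrix.ext_iff]
  refine forall_congr' fun i => forall_congr' fun j => ?_
  rw [adj_apply, Matrix.neg_apply, mul_assoc, inv_mul_eq_iff_eq_mul₀ (D.algebraMap_d_ne_zero i),
    mul_neg, add_eq_zero_iff_eq_neg]

lemma mem_unitaryGrp_iff_adj (D : IsUnitaryData θ ω a d) {g : GL (Fin m) E} :
    g ∈ unitaryGrp θ (diagT E d) ↔ adj θ d g.1 * g.1 = 1 := by
  change conjT θ g.1 * diagT E d * g.1 = diagT E d ↔ _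
  constructor
  · intro h
    rw [adj, mul_assoc, mul_assoc, ← mul_assoc (conjT θ g.1), h, D.diagT_inv_mul]
  · intro h
    calc conjT θ g.1 * diagT E d * g.1
        = (diagT E d * diagT E d⁻¹) * (conjT θ g.1 * diagT E d * g.1) := by
          rw [D.diagT_mul_inv, one_mul]
      _ = diagT E d * (adj θ d g.1 * g.1) := by simp only [adj, mul_assoc]
      _ = diagT E d := by rw [h, mul_one]

lemma mul_mul_adj_mem (D : IsUnitaryData θ ω a d) (A : Matrix (Fin m) (Fin m) E)
    {z : Matrix (Fin m) (Fin m) E} (hz : z ∈ lieAlg θ (diagT E d)) :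
    A * z * adj θ d A ∈ lieAlg θ (diagT E d) := by
  rw [D.mem_lieAlg_iff_adj] at hz ⊢
  rw [D.adj_mul, D.adj_mul, D.adj_adj, hz]
  simp only [neg_mul, mul_neg, mul_assoc]

/-- The action `A • z = A z A^†` of `GL_m(E)` on `𝔤`. -/
abbrev conjAction (D : IsUnitaryData θ ω a d) :
    DistribMulAction (GL (Fin m) E) (lieAlg θ (diagT E d)) where
  smul A z := ⟨A.1 * z.1 * adj θ d A.1, D.mul_mul_adj_mem A.1 z.2⟩
  one_smul z := Subtype.ext (by
    change (1 : Matrix (Fin m) (Fin m) E) * z.1 * adj θ d 1 = z.1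
    rw [D.adj_one, one_mul, mul_one])
  mul_smul A B z := Subtype.ext (by
    change A.1 * B.1 * z.1 * adj θ d (A.1 * B.1) = A.1 * (B.1 * z.1 * adj θ d B.1) * adj θ d A.1
    rw [D.adj_mul]
    simp only [mul_assoc])
  smul_zero A := Subtype.ext (by
    change A.1 * (0 : Matrix (Fin m) (Fin m) E) * adj θ d A.1 = 0
    rw [mul_zero, zero_mul])
  smul_add A y z := Subtype.ext (by
    change A.1 * (y.1 + z.1) * adj θ d A.1 = A.1 * y.1 * adj θ d A.1 + A.1 * z.1 * adj θ d A.1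
    rw [mul_add, add_mul])

end IsUnitaryData

end Adjoint

/-! ### The Haar measure on `𝔤` -/

lemma two_mul_card_abovePos_add (m : ℕ) : 2 * Fintype.card (AbovePos m) + m = m * m := by
  have h1 : Fintype.card (AbovePos m) =
      (Finset.univ.filter fun p : Fin m × Fin m => p.1.val + p.2.val + 1 < m).card :=
    Fintype.card_subtype _
  have h2 : (Finset.univ.filter fun p : Fin m × Fin m => p.1.val + p.2.val + 1 < m).card =
      (Finset.univ.filter fun p : Fin m × Fin m => m < p.1.val + p.2.val + 1).card := by
    refine Finset.card_bij' (fun p _ => (p.2.rev, p.1.rev)) (fun p _ => (p.2.rev, p.1.rev))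
      ?_ ?_ (by simp) (by simp) <;>
    · rintro ⟨⟨i, hi⟩, ⟨j, hj⟩⟩ h
      simp only [Finset.mem_filter, Finset.mem_univ, true_and, Fin.val_rev] at h ⊢
      omega
  have h3 : (Finset.univ.filter fun p : Fin m × Fin m => p.1.val + p.2.val + 1 = m).card = m := by
    conv_rhs => rw [← Fintype.card_fin m, ← Finset.card_univ]
    refine Finset.card_bij' (fun p _ => p.1) (fun i _ => (i, i.rev)) (by simp) ?_ ?_ (by simp)
    · rintro ⟨i, hi⟩ -
      simp only [Finset.mem_filter, Finset.mem_univ, true_and, Fin.val_rev]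
      omega
    · rintro ⟨⟨i, hi⟩, ⟨j, hj⟩⟩ h
      simp only [Finset.mem_filter, Finset.mem_univ, true_and] at h
      simp only [Prod.mk.injEq, true_and, Fin.ext_iff, Fin.val_rev]
      omega
  have h4 : (Finset.univ : Finset (Fin m × Fin m)).card = m * m := by simp
  have h5 := Finset.card_filter_add_card_filter_not (s := (Finset.univ : Finset (Fin m × Fin m)))
    (fun p => p.1.val + p.2.val + 1 < m)
  have h6 := Finset.card_filter_add_card_filter_not
    (s := (Finset.univ.filter fun p : Fin m × Fin m => ¬ p.1.val + p.2.val + 1 < m))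
    (fun p => p.1.val + p.2.val + 1 = m)
  rw [Finset.filter_filter, Finset.filter_filter] at h6
  have h7 : (Finset.univ.filter fun p : Fin m × Fin m =>
      ¬ p.1.val + p.2.val + 1 < m ∧ p.1.val + p.2.val + 1 = m) =
      Finset.univ.filter fun p : Fin m × Fin m => p.1.val + p.2.val + 1 = m :=
    Finset.filter_congr fun p _ => by omega
  have h8 : (Finset.univ.filter fun p : Fin m × Fin m =>
      ¬ p.1.val + p.2.val + 1 < m ∧ ¬ p.1.val + p.2.val + 1 = m) =
      Finset.univ.filter fun p : Fin m × Fin m => m < p.1.val + p.2.val + 1 :=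
    Finset.filter_congr fun p _ => by omega
  rw [h7, h8] at h6
  omega

section HaarLie

variable {F E : Type*}
  [Field F] [ValuativeRel F] [TopologicalSpace F] [IsNonarchimedeanLocalField F]
  [Field E] [ValuativeRel E] [TopologicalSpace E] [IsNonarchimedeanLocalField E] [CharZero E]
  [Algebra F E] [ValuativeExtension F E]
  {m : ℕ} {θ : E ≃+* E} {ω : E} {a : F} {d : Fin m → F}

instance : SecondCountableTopology (Matrix (Fin m) (Fin m) E) :=
  inferInstanceAs (SecondCountableTopology (Fin m → Fin m → E))

instance (θ : E ≃+* E) (T : Matrix (Fin m) (Fin m) E) : SecondCountableTopology (lieAlg θ T) :=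
  TopologicalSpace.Subtype.secondCountableTopology (lieAlg θ T : Set (Matrix (Fin m) (Fin m) E))

namespace IsUnitaryData

omit [ValuativeRel F] [TopologicalSpace F] [IsNonarchimedeanLocalField F] [ValuativeRel E]
  [TopologicalSpace E] [IsNonarchimedeanLocalField E] [CharZero E] [ValuativeExtension F E] in
lemma theta_apply_eq (D : IsUnitaryData θ ω a d) (y : lieAlg θ (diagT E d)) (i j : Fin m) :
    -(θ (y.1 j i / algebraMap F E (d i))) * algebraMap F E (d j) = y.1 i j := by
  have h := (mem_lieAlg_iff y.1).1 y.2 i j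
  have hi := D.algebraMap_d_ne_zero i
  rw [map_div₀, D.map_algebraMap]
  field_simp
  linear_combination -h

omit [ValuativeRel F] [TopologicalSpace F] [IsNonarchimedeanLocalField F] [ValuativeRel E]
  [TopologicalSpace E] [IsNonarchimedeanLocalField E] [CharZero E] [ValuativeExtension F E] in
lemma _root_.CayleyUnitary.skewOfCoords_mul_apply (c : (AbovePos m → E) × (Fin m → F))
    (i j : Fin m) : (skewOfCoords θ ω c * wMat E m * diagT E d) i j =
      (if h : i.val + j.rev.val + 1 < m then c.1 ⟨(i, j.rev), h⟩
      else if h' : i.val + j.rev.val + 1 = m then algebraMap F E (c.2 i) * ω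
      else -θ (c.1 ⟨(j.rev.rev, i.rev), by simp only [Fin.val_rev] at *; omega⟩)) *
        algebraMap F E (d j) := by
  simp only [diagT, Matrix.mul_diagonal, mul_wMat_apply, skewOfCoords, Matrix.of_apply]

/-- The parametrization `c ↦ x w_m T` of `𝔤` by the entries `c` of `x` on and above the second
diagonal, as an isomorphism of topological groups. -/
def coordEquiv (D : IsUnitaryData θ ω a d) :
    ((AbovePos m → E) × (Fin m → F)) ≃ₜ+ lieAlg θ (diagT E d) where
  toFun c := ⟨skewOfCoords θ ω c * wMat E m * diagT E d,
    mul_wMat_mul_mem θ (conjT_diagonal θ D.map_algebraMap d)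
      (skewOfCoords_mem θ D.invol D.map_algebraMap D.theta_omega c)⟩
  invFun y := (fun p => y.1 p.1.1 p.1.2.rev / algebraMap F E (d p.1.2.rev),
    fun i => (D.quadEquiv.symm (y.1 i i / algebraMap F E (d i))).2)
  left_inv c := by
    have hd := D.algebraMap_d_ne_zero
    refine Prod.ext (funext fun p => ?_) (funext fun i => ?_)
    · simp [diagT, Matrix.mul_diagonal, mul_wMat_apply, skewOfCoords, p.2, hd]
    · have h2 : ¬ i.val + i.rev.val + 1 < m := by simp only [Fin.val_rev]; omega
      have h3 : i.val + i.rev.val + 1 = m := by simp only [Fin.val_rev]; omega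
      have : D.quadEquiv (0, c.2 i) = algebraMap F E (c.2 i) * ω := by simp [quadEquiv_apply]
      simp only [diagT, Matrix.mul_diagonal, mul_wMat_apply, skewOfCoords, Matrix.of_apply,
        dif_neg h2, dif_pos h3, mul_div_cancel_right₀ _ (hd i)]
      rw [← this, ContinuousAddEquiv.symm_apply_apply]
  right_inv y := by
    refine Subtype.ext (Matrix.ext fun i j => ?_)
    have hd := D.algebraMap_d_ne_zero
    simp only [diagT, Matrix.mul_diagonal, mul_wMat_apply, skewOfCoords, Matrix.of_apply,
      Fin.rev_rev]
    split_ifs with h h'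
    · exact div_mul_cancel₀ _ (hd j)
    · obtain rfl : i = j := by
        ext; simp only [Fin.val_rev] at h'; omega
      have hy := D.theta_apply_eq y i i
      obtain ⟨t, ht⟩ := D.exists_eq_mul_omega (x := y.1 i i / algebraMap F E (d i)) (by
        rw [eq_neg_iff_add_eq_zero, ← neg_eq_iff_add_eq_zero, eq_div_iff (hd i)]; exact hy)
      have : D.quadEquiv (0, t) = algebraMap F E t * ω := by simp [quadEquiv_apply]
      rw [← ht, ← this, ContinuousAddEquiv.symm_apply_apply, ht]
      exact div_mul_cancel₀ _ (hd i)
    · exact D.theta_apply_eq y i j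
  map_add' c c' := by
    refine Subtype.ext (Matrix.ext fun i j => ?_)
    change (skewOfCoords θ ω (c + c') * wMat E m * diagT E d) i j =
      (skewOfCoords θ ω c * wMat E m * diagT E d) i j +
        (skewOfCoords θ ω c' * wMat E m * diagT E d) i j
    simp only [skewOfCoords_mul_apply, Prod.fst_add, Prod.snd_add, Pi.add_apply, map_add]
    split_ifs <;> ring
  continuous_toFun := by
    have := continuous_algebraMap_of_valuativeExtension (F := F) (E := E)
    have := D.continuous_theta
    refine Continuous.subtype_mk (continuous_matrix fun i j => ?_) _
    simp only [diagT, Matrix.mul_diagonal, mul_wMat_apply, skewOfCoords, Matrix.of_apply]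
    split_ifs <;> fun_prop
  continuous_invFun := by
    have h : ∀ i j, Continuous fun y : lieAlg θ (diagT E d) => y.1 i j := fun i j =>
      continuous_subtype_val.matrix_elem i j
    refine Continuous.prodMk (continuous_pi fun p => ?_) (continuous_pi fun i => ?_)
    · exact (h _ _).div_const _
    · exact continuous_snd.comp (D.quadEquiv.symm.continuous.comp ((h _ _).div_const _))

lemma coordEquiv_apply (D : IsUnitaryData θ ω a d) (c : (AbovePos m → E) × (Fin m → F)) :
    (D.coordEquiv c).1 = skewOfCoords θ ω c * wMat E m * diagT E d := rfl

lemma locallyCompactSpace_lieAlg (D : IsUnitaryData θ ω a d) :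
    LocallyCompactSpace (lieAlg θ (diagT E d)) :=
  D.coordEquiv.symm.toHomeomorph.isClosedEmbedding.locallyCompactSpace

omit [ValuativeRel F] [TopologicalSpace F] [IsNonarchimedeanLocalField F] [CharZero E]
  [ValuativeExtension F E] in
lemma continuousConstSMul_conjAction (D : IsUnitaryData θ ω a d) :
    let _ := D.conjAction
    ContinuousConstSMul (GL (Fin m) E) (lieAlg θ (diagT E d)) := by
  let _ := D.conjAction
  refine ⟨fun A => Continuous.subtype_mk ?_ _⟩
  fun_prop

lemma distribHaarChar_conjAction_scalar (D : IsUnitaryData θ ω a d) (x : Eˣ) :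
    let _ := D.conjAction
    have := D.continuousConstSMul_conjAction
    have := D.locallyCompactSpace_lieAlg
    distribHaarChar (lieAlg θ (diagT E d)) (scalarGL x : GL (Fin m) E) =
      distribHaarChar E x ^ (m * m) := by
  intro _ _ _
  obtain ⟨c, hc⟩ := D.exists_norm x
  have hcont : ContinuousConstSMul F E := ⟨fun c => by
    simp_rw [Algebra.smul_def]
    fun_prop⟩
  have h1 : distribHaarChar E c = distribHaarChar E x ^ 2 := by
    rw [← D.distribHaarChar_norm hc, ← D.distribHaarChar_algebraMap]
    exact distribHaarChar_congr (ContinuousAddEquiv.refl E) fun y => by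
      simp [Units.smul_def, Algebra.smul_def]
  have h2 := distribHaarChar_congr (A := (AbovePos m → E) × (Fin m → F)) D.coordEquiv (g := c)
    (h := (scalarGL x : GL (Fin m) E)) (fun p => by
      refine Subtype.ext (Matrix.ext fun i j => ?_)
      change _ = ((scalarGL x : GL (Fin m) E).1 * (D.coordEquiv p).1 *
        adj θ d (scalarGL x : GL (Fin m) E).1) i j
      have hadj : adj θ d (scalarGL x : GL (Fin m) E).1 = Matrix.diagonal fun _ => θ x := by
        ext k l
        rw [adj_apply, coe_scalarGL]
        have hd := D.algebraMap_d_ne_zero k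
        by_cases hkl : k = l
        · subst hkl
          simp only [Matrix.diagonal_apply_eq]
          field_simp
        · simp [Matrix.diagonal_apply_ne _ hkl, Matrix.diagonal_apply_ne _ (Ne.symm hkl)]
      rw [hadj, coe_scalarGL, Matrix.mul_diagonal, Matrix.diagonal_mul]
      have hs1 : ∀ q, (c • p).1 q = algebraMap F E c * p.1 q := fun q => Algebra.smul_def _ _
      have hs2 : (c • p).2 i = c * p.2 i := rfl
      simp only [D.coordEquiv_apply, skewOfCoords_mul_apply, hs1, hs2, map_mul,
        D.invol, hc]
      split_ifs <;> ring)
  rw [← h2, distribHaarChar_prod, distribHaarChar_pi, distribHaarChar_pi, h1,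
    D.distribHaarChar_norm hc, ← pow_mul, ← pow_add, Fintype.card_fin, two_mul_card_abovePos_add]

lemma distribHaarChar_conjAction (D : IsUnitaryData θ ω a d) (A : GL (Fin m) E) :
    let _ := D.conjAction
    have := D.continuousConstSMul_conjAction
    have := D.locallyCompactSpace_lieAlg
    distribHaarChar (lieAlg θ (diagT E d)) A =
      distribHaarChar E (Matrix.GeneralLinearGroup.det A) ^ m := by
  intro _ _ _
  rcases Nat.eq_zero_or_pos m with rfl | hm
  · rw [Subsingleton.elim A 1, map_one, pow_zero]
  · refine pow_left_injective hm.ne' ?_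
    simp only
    rw [map_pow_eq_map_scalar_det, D.distribHaarChar_conjAction_scalar, pow_mul]

variable [MeasurableSpace F] [BorelSpace F] [MeasurableSpace E] [BorelSpace E]

lemma mu_eq_map (D : IsUnitaryData θ ω a d) :
    mu D = ((Measure.pi fun _ : AbovePos m => haarO E).prod
      (Measure.pi fun _ : Fin m => haarO F)).map D.coordEquiv := by
  have h := continuous_algebraMap_of_valuativeExtension (F := F) (E := E)
  have h' := D.continuous_theta
  rw [mu, dx, Measure.map_map]
  · rfl
  · refine Continuous.measurable (Continuous.subtype_mk ?_ _)
    fun_prop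
  · refine Continuous.measurable (Continuous.subtype_mk (continuous_matrix fun i j => ?_) _)
    simp only [skewOfCoords, Matrix.of_apply]
    split_ifs <;> fun_prop

lemma isAddHaarMeasure_mu (D : IsUnitaryData θ ω a d) : (mu D).IsAddHaarMeasure := by
  rw [mu_eq_map]
  have h1 : (Measure.pi fun _ : AbovePos m => haarO E).IsAddHaarMeasure := inferInstance
  have h2 : (Measure.pi fun _ : Fin m => haarO F).IsAddHaarMeasure := inferInstance
  have h3 := Measure.prod.instIsAddHaarMeasure (Measure.pi fun _ : AbovePos m => haarO E)
    (Measure.pi fun _ : Fin m => haarO F)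
  exact D.coordEquiv.isAddHaarMeasure_map _

/-- The linear map `z ↦ A z A^†` scales the measure `μ` by `|det A|^m`. -/
lemma mu_image_conj (D : IsUnitaryData θ ω a d) (A : GL (Fin m) E)
    (s : Set (lieAlg θ (diagT E d))) :
    mu D ((fun z => ⟨A.1 * z.1 * adj θ d A.1, D.mul_mul_adj_mem A.1 z.2⟩) '' s) =
      ENNReal.ofReal (absVal A.1.det ^ m) * mu D s := by
  let _ := D.conjAction
  have := D.continuousConstSMul_conjAction
  have := D.locallyCompactSpace_lieAlg
  have := D.isAddHaarMeasure_mu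
  have : (mu D).Regular := by
    rw [Measure.isAddLeftInvariant_eq_smul (mu D) Measure.addHaar]
    infer_instance
  have h := distribHaarChar_mul (mu D) A s
  rw [D.distribHaarChar_conjAction] at h
  rw [← Matrix.GeneralLinearGroup.val_det_apply,
    ← distribHaarChar_eq_absVal (Matrix.GeneralLinearGroup.det A), ← NNReal.coe_pow,
    ENNReal.ofReal_coe_nnreal, h]
  rfl

end IsUnitaryData

end HaarLie

/-! ### Matrices with small entries -/

section Entries

variable {E : Type*} [Field E] [ValuativeRel E] {m : ℕ}
  {α β γ : ValueGroupWithZero E} {A B M : Matrix (Fin m) (Fin m) E}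

/-- All entries of `M` have valuation at most `γ`. -/
def EntryLe (γ : ValueGroupWithZero E) (M : Matrix (Fin m) (Fin m) E) : Prop :=
  ∀ i j, valuation E (M i j) ≤ γ

/-- All entries of `M` have valuation less than `γ`. -/
def EntryLt (γ : ValueGroupWithZero E) (M : Matrix (Fin m) (Fin m) E) : Prop :=
  ∀ i j, valuation E (M i j) < γ

lemma EntryLt.le (h : EntryLt γ M) : EntryLe γ M := fun i j => (h i j).le

lemma EntryLe.mono (h : EntryLe α M) (hαβ : α ≤ β) : EntryLe β M := fun i j => (h i j).trans hαβ

lemma EntryLt.mono (h : EntryLt α M) (hαβ : α ≤ β) : EntryLt β M :=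
  fun i j => (h i j).trans_le hαβ

lemma EntryLe.add (hA : EntryLe γ A) (hB : EntryLe γ B) : EntryLe γ (A + B) :=
  fun i j => (valuation E).map_add_le (hA i j) (hB i j)

lemma EntryLt.add (hA : EntryLt γ A) (hB : EntryLt γ B) : EntryLt γ (A + B) :=
  fun i j => (valuation E).map_add_lt (hA i j) (hB i j)

lemma EntryLt.neg (hA : EntryLt γ A) : EntryLt γ (-A) := fun i j => by
  rw [Matrix.neg_apply, Valuation.map_neg]; exact hA i j

lemma EntryLe.neg (hA : EntryLe γ A) : EntryLe γ (-A) := fun i j => by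
  rw [Matrix.neg_apply, Valuation.map_neg]; exact hA i j

lemma entryLe_one (hγ : 1 ≤ γ) : EntryLe γ (1 : Matrix (Fin m) (Fin m) E) := fun i j => by
  rw [Matrix.one_apply]
  split_ifs
  · rwa [map_one]
  · simp

lemma entryLt_zero (hγ : γ ≠ 0) : EntryLt γ (0 : Matrix (Fin m) (Fin m) E) := fun i j => by
  simpa using zero_lt_iff.2 hγ

lemma EntryLt.mul_right (hA : EntryLe α A) (hB : EntryLt β B) (hα : α ≠ 0) (hβ : β ≠ 0) :
    EntryLt (α * β) (A * B) := fun i j => by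
  rw [Matrix.mul_apply]
  refine (valuation E).map_sum_lt (mul_ne_zero hα hβ) fun k _ => ?_
  rw [map_mul]
  exact mul_lt_mul_of_le_of_lt_of_nonneg_of_pos (hA i k) (hB k j) zero_le (zero_lt_iff.2 hα)

lemma EntryLt.mul_left (hA : EntryLt α A) (hB : EntryLe β B) (hα : α ≠ 0) (hβ : β ≠ 0) :
    EntryLt (α * β) (A * B) := fun i j => by
  rw [Matrix.mul_apply]
  refine (valuation E).map_sum_lt (mul_ne_zero hα hβ) fun k _ => ?_
  rw [map_mul]
  exact mul_lt_mul_of_lt_of_le_of_nonneg_of_pos (hA i k) (hB k j) zero_le (zero_lt_iff.2 hβ)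

/-- A matrix that is congruent to `1` modulo the maximal ideal is invertible over the ring of
integers. -/
lemma EntryLt.exists_inv (hM : EntryLt 1 M) :
    valuation E (1 + M).det = 1 ∧ ∃ P, (1 + M) * P = 1 ∧ P * (1 + M) = 1 ∧ EntryLe 1 P := by
  let M₀ : Matrix (Fin m) (Fin m) 𝒪[E] := Matrix.of fun i j => ⟨M i j, (hM i j).le⟩
  have hM₀ : (1 + M₀).map (algebraMap 𝒪[E] E) = 1 + M := by
    ext i j
    by_cases h : i = j <;> simp [M₀, h] <;> rfl
  have hres : (1 + M₀).map (IsLocalRing.residue 𝒪[E]) = 1 := by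
    have : M₀.map (IsLocalRing.residue 𝒪[E]) = 0 := by
      ext i j
      rw [Matrix.map_apply, Matrix.zero_apply, IsLocalRing.residue_eq_zero_iff,
        IsLocalRing.mem_maximalIdeal, mem_nonunits_iff,
        Valuation.Integer.not_isUnit_iff_valuation_lt_one]
      exact hM i j
    rw [Matrix.map_add _ (map_add _), this, add_zero,
      Matrix.map_one _ (map_zero _) (map_one _)]
  have hdet : IsUnit (1 + M₀).det := by
    have h := (IsLocalRing.residue 𝒪[E]).map_det (1 + M₀)
    rw [RingHom.mapMatrix_apply, hres, Matrix.det_one] at h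
    by_contra h'
    rw [← mem_nonunits_iff, ← IsLocalRing.mem_maximalIdeal, ← IsLocalRing.residue_eq_zero_iff,
      h] at h'
    exact one_ne_zero h'
  refine ⟨?_, (1 + M₀)⁻¹.map (algebraMap 𝒪[E] E), ?_, ?_, fun i j => ((1 + M₀)⁻¹ i j).2⟩
  · have h := (algebraMap 𝒪[E] E).map_det (1 + M₀)
    rw [RingHom.mapMatrix_apply, hM₀] at h
    rw [← h]
    exact Valuation.Integers.one_of_isUnit (Valuation.integer.integers (valuation E)) hdet
  · rw [← hM₀, ← Matrix.map_mul, Matrix.mul_nonsing_inv _ hdet,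
      Matrix.map_one _ (map_zero _) (map_one _)]
  · rw [← hM₀, ← Matrix.map_mul, Matrix.nonsing_inv_mul _ hdet,
      Matrix.map_one _ (map_zero _) (map_one _)]

lemma EntryLt.exists_inv_sub (hM : EntryLt 1 M) :
    valuation E (1 - M).det = 1 ∧ ∃ P, (1 - M) * P = 1 ∧ P * (1 - M) = 1 ∧ EntryLe 1 P := by
  have := hM.neg.exists_inv
  rwa [← sub_eq_add_neg] at this

/-- If `y` is bounded by `γ⁻¹` and `z` by `γ`, then `1 + y z` is invertible and
`z (1 + y z)⁻¹` is bounded by `γ`. -/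
lemma exists_inv_one_add_mul {y z : Matrix (Fin m) (Fin m) E} (hγ : γ ≠ 0)
    (hy : EntryLe γ⁻¹ y) (hz : EntryLt γ z) :
    valuation E (1 + y * z).det = 1 ∧
      ∃ P, (1 + y * z) * P = 1 ∧ P * (1 + y * z) = 1 ∧ EntryLt γ (z * P) := by
  have h : EntryLt 1 (y * z) := by
    have := EntryLt.mul_right hy hz (inv_ne_zero hγ) hγ
    rwa [inv_mul_cancel₀ hγ] at this
  obtain ⟨h1, P, h2, h3, h4⟩ := h.exists_inv
  refine ⟨h1, P, h2, h3, ?_⟩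
  have := EntryLt.mul_left hz h4 hγ one_ne_zero
  rwa [mul_one] at this

lemma entryLt_one_add_mul_mul_one_sub {y z : Matrix (Fin m) (Fin m) E} (hγ : γ ≠ 0) (hα : 1 ≤ α)
    (hy : EntryLe α y) (hz : EntryLt γ z) : EntryLt (α * γ * α) ((1 + y) * z * (1 - y)) := by
  have hα0 : α ≠ 0 := (zero_lt_one.trans_le hα).ne'
  refine EntryLt.mul_left (EntryLt.mul_right ((entryLe_one hα).add hy) hz hα0 hγ) ?_
    (mul_ne_zero hα0 hγ) hα0
  rw [sub_eq_add_neg]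
  exact (entryLe_one hα).add hy.neg

end Entries

/-! ### The product formula for Cayley transforms -/

section ProductFormula

variable {R : Type*} [Ring R] {g k y z P Q : R}

lemma one_sub_cayley_sum (hP : (1 + y * z) * P = 1) :
    1 - (y + (1 + y) * (z * P) * (1 - y)) = (1 - z) * P * (1 - y) := by
  have h : y * z * P = 1 - P := by rw [← hP]; noncomm_ring
  calc 1 - (y + (1 + y) * (z * P) * (1 - y)) = (1 - z * P - y * z * P) * (1 - y) := by noncomm_ring
    _ = (1 - z) * P * (1 - y) := by rw [h]; noncomm_ring

lemma cayley_mul_cayley (hg : g * (1 - y) = 1 + y) (hQ : (1 - y) * Q = 1) (hQ' : Q * (1 - y) = 1)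
    (hk : k * (1 - z) = 1 + z) (hP : (1 + y * z) * P = 1) :
    g * k * (1 - (y + (1 + y) * (z * P) * (1 - y))) = 1 + (y + (1 + y) * (z * P) * (1 - y)) := by
  have hg' : (1 - y) * g = 1 + y := by
    have h1 : g = (1 + y) * Q := by rw [← hg, mul_assoc, hQ, mul_one]
    have h2 : (1 - y) * (1 + y) = (1 + y) * (1 - y) := by noncomm_ring
    rw [h1, ← mul_assoc, h2, mul_assoc, hQ, mul_one]
  have h : y * z * P = 1 - P := by rw [← hP]; noncomm_ring
  have key : (1 - y) * (g * k * (1 - (y + (1 + y) * (z * P) * (1 - y)))) =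
      (1 - y) * (1 + (y + (1 + y) * (z * P) * (1 - y))) := by
    calc (1 - y) * (g * k * (1 - (y + (1 + y) * (z * P) * (1 - y))))
        = ((1 - y) * g) * (k * (1 - z)) * P * (1 - y) := by
          rw [one_sub_cayley_sum hP]; simp only [mul_assoc]
      _ = (1 + y) * ((P + z * P) * (1 - y)) := by rw [hg', hk]; noncomm_ring
      _ = (1 + y) * ((1 + z * P - y * z * P) * (1 - y)) := by rw [h]; noncomm_ring
      _ = (1 - y) * (1 + (y + (1 + y) * (z * P) * (1 - y))) := by noncomm_ring
  have := congrArg (Q * ·) key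
  simpa only [← mul_assoc, hQ', one_mul] using this

end ProductFormula

/-! ### Lattices in `𝔤` and congruence subgroups of `G` -/

section Congruence

variable {F E : Type*} [Field F] [Field E] [ValuativeRel E] [Algebra F E]
  {m : ℕ} {θ : E ≃+* E} {ω : E} {a : F} {d : Fin m → F} {γ : ValueGroupWithZero E}

namespace IsUnitaryData

omit [ValuativeRel E] in
lemma adj_one_sub (D : IsUnitaryData θ ω a d) {y : Matrix (Fin m) (Fin m) E}
    (hy : y ∈ lieAlg θ (diagT E d)) : adj θ d (1 - y) = 1 + y := by
  rw [adj_sub, D.adj_one, D.mem_lieAlg_iff_adj.1 hy, sub_neg_eq_add]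

omit [ValuativeRel E] in
lemma adj_one_add (D : IsUnitaryData θ ω a d) {y : Matrix (Fin m) (Fin m) E}
    (hy : y ∈ lieAlg θ (diagT E d)) : adj θ d (1 + y) = 1 - y := by
  rw [adj_add, D.adj_one, D.mem_lieAlg_iff_adj.1 hy, sub_eq_add_neg]

omit [ValuativeRel E] in
lemma det_one_add (D : IsUnitaryData θ ω a d) {y : Matrix (Fin m) (Fin m) E}
    (hy : y ∈ lieAlg θ (diagT E d)) : (1 + y).det = θ (1 - y).det := by
  rw [← D.adj_one_sub hy, D.det_adj]

omit [ValuativeRel E] in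
/-- `z (1 + y z)⁻¹` lies in `𝔤`. -/
lemma mul_inv_mem (D : IsUnitaryData θ ω a d) {y z P : Matrix (Fin m) (Fin m) E}
    (hy : y ∈ lieAlg θ (diagT E d)) (hz : z ∈ lieAlg θ (diagT E d))
    (hP : (1 + y * z) * P = 1) : z * P ∈ lieAlg θ (diagT E d) := by
  rw [D.mem_lieAlg_iff_adj, D.adj_mul]
  have h := congrArg (adj θ d) hP
  rw [D.adj_mul, adj_add, D.adj_mul, D.adj_one, D.mem_lieAlg_iff_adj.1 hy,
    D.mem_lieAlg_iff_adj.1 hz, neg_mul_neg] at h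
  rw [D.mem_lieAlg_iff_adj.1 hz]
  calc adj θ d P * -z = -(adj θ d P * (z * ((1 + y * z) * P))) := by rw [hP]; simp
    _ = -(adj θ d P * (1 + z * y) * (z * P)) := by noncomm_ring
    _ = -(z * P) := by rw [h, one_mul]

/-- The lattice of all `z ∈ 𝔤` whose entries have valuation less than `γ`. -/
def _root_.CayleyUnitary.lattice (θ : E ≃+* E) (d : Fin m → F) (γ : ValueGroupWithZero E) :
    Set (lieAlg θ (diagT E d)) := {z | EntryLt γ z.1}

/-- The map `z ↦ y + (1 + y) z (1 - y)` on `𝔤`. -/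
def shift (D : IsUnitaryData θ ω a d) (y z : lieAlg θ (diagT E d)) : lieAlg θ (diagT E d) :=
  y + ⟨(1 + y.1) * z.1 * adj θ d (1 + y.1), D.mul_mul_adj_mem _ z.2⟩

omit [ValuativeRel E] in
lemma coe_shift (D : IsUnitaryData θ ω a d) (y z : lieAlg θ (diagT E d)) :
    (D.shift y z).1 = y.1 + (1 + y.1) * z.1 * (1 - y.1) := by
  rw [← D.adj_one_add y.2]; rfl

/-- The elements of `G` that are Cayley transforms of elements of the lattice of level `γ`. -/
def congruenceSet (_ : IsUnitaryData θ ω a d) (γ : ValueGroupWithZero E) :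
    Set (unitaryGrp θ (diagT E d)) :=
  {k | ∃ z ∈ lattice θ d γ, k.1.1 * (1 - z.1) = 1 + z.1}

/-- `𝒞(y) 𝒞(z)` for `z` in the lattice of level `γ` is the Cayley transform of an element of
`y + (1 + y) L_γ (1 - y)`. -/
lemma exists_shift_of_mem_congruenceSet (D : IsUnitaryData θ ω a d) (hγ : γ ≠ 0)
    {g k : unitaryGrp θ (diagT E d)} {y : lieAlg θ (diagT E d)}
    (hy : EntryLe γ⁻¹ y.1) (hdet : (1 - y.1).det ≠ 0) (hg : g.1.1 * (1 - y.1) = 1 + y.1)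
    (hk : k ∈ D.congruenceSet γ) :
    ∃ z ∈ lattice θ d γ, (g * k).1.1 * (1 - (D.shift y z).1) = 1 + (D.shift y z).1 := by
  obtain ⟨z, hz, hk⟩ := hk
  obtain ⟨-, P, hP, -, hzP⟩ := exists_inv_one_add_mul hγ hy hz
  refine ⟨⟨z.1 * P, D.mul_inv_mem y.2 z.2 hP⟩, hzP, ?_⟩
  rw [coe_shift]
  exact cayley_mul_cayley hg (Matrix.mul_nonsing_inv _ (isUnit_iff_ne_zero.2 hdet))
    (Matrix.nonsing_inv_mul _ (isUnit_iff_ne_zero.2 hdet)) hk hP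

/-- Every element of `y + (1 + y) L_γ (1 - y)` is of the form considered in
`one_sub_cayley_sum`. -/
lemma exists_eq_mul_inv (D : IsUnitaryData θ ω a d) (hγ : γ ≠ 0)
    {y z : lieAlg θ (diagT E d)} (hy : EntryLe γ⁻¹ y.1) (hz : z ∈ lattice θ d γ) :
    ∃ x ∈ lattice θ d γ, ∃ P, (1 + y.1 * x.1) * P = 1 ∧
      valuation E (1 + y.1 * x.1).det = 1 ∧ z.1 = x.1 * P := by
  have hny : EntryLe γ⁻¹ (-y).1 := hy.neg
  obtain ⟨-, P, hP, hP', hzP⟩ := exists_inv_one_add_mul hγ hny hz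
  let x : lieAlg θ (diagT E d) := ⟨z.1 * P, D.mul_inv_mem (-y).2 z.2 hP⟩
  have hP₀ : (1 - y.1 * z.1) * P = 1 := by
    simpa only [AddSubgroup.coe_neg, neg_mul, ← sub_eq_add_neg] using hP
  have hP₁ : P * (1 - y.1 * z.1) = 1 := by
    simpa only [AddSubgroup.coe_neg, neg_mul, ← sub_eq_add_neg] using hP'
  have hx : 1 + y.1 * x.1 = P := by
    change 1 + y.1 * (z.1 * P) = P
    rw [← hP₀]; noncomm_ring
  refine ⟨x, hzP, 1 - y.1 * z.1, by rw [hx, hP₁],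
    (exists_inv_one_add_mul hγ hy hzP).1, ?_⟩
  change z.1 = z.1 * P * (1 - y.1 * z.1)
  rw [mul_assoc, hP₁, mul_one]

lemma valuation_det_one_sub_shift (D : IsUnitaryData θ ω a d) (hγ : γ ≠ 0) (hγ1 : γ ≤ 1)
    {y z : lieAlg θ (diagT E d)} (hy : EntryLe γ⁻¹ y.1) (hz : z ∈ lattice θ d γ) :
    valuation E (1 - (D.shift y z).1).det = valuation E (1 - y.1).det := by
  obtain ⟨x, hx, P, hP, hv, hzx⟩ := D.exists_eq_mul_inv hγ hy hz
  have hP1 : valuation E P.det = 1 := by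
    have := congrArg (fun M => valuation E (Matrix.det M)) hP
    simpa [Matrix.det_mul, hv] using this
  rw [coe_shift, hzx, one_sub_cayley_sum hP, Matrix.det_mul, Matrix.det_mul, map_mul, map_mul,
    hP1, (EntryLt.mono hx hγ1).exists_inv_sub.1, one_mul, one_mul]

lemma entryLe_shift (D : IsUnitaryData θ ω a d) (hγ : γ ≠ 0) (hγ1 : γ ≤ 1)
    {y z : lieAlg θ (diagT E d)} (hy : EntryLe γ⁻¹ y.1) (hz : z ∈ lattice θ d γ) :
    EntryLe γ⁻¹ (D.shift y z).1 := by
  have h := entryLt_one_add_mul_mul_one_sub hγ ((one_le_inv₀ (zero_lt_iff.2 hγ)).2 hγ1) hy hz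
  rw [inv_mul_cancel₀ hγ, one_mul] at h
  rw [coe_shift]
  exact hy.add h.le

lemma shift_mem_lattice (D : IsUnitaryData θ ω a d) (hγ : γ ≠ 0) (hγ1 : γ ≤ 1)
    {y z : lieAlg θ (diagT E d)} (hy : y ∈ lattice θ d γ) (hz : z ∈ lattice θ d γ) :
    D.shift y z ∈ lattice θ d γ := by
  have h := entryLt_one_add_mul_mul_one_sub hγ le_rfl ((EntryLt.mono hy hγ1).le) hz
  rw [mul_one, one_mul] at h
  change EntryLt γ _
  rw [coe_shift]
  exact EntryLt.add hy h

/-- The congruence subgroup `𝒞(L_γ)` of `G`. -/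
def congruenceSubgroup (D : IsUnitaryData θ ω a d) (hγ : γ ≠ 0) (hγ1 : γ ≤ 1) :
    Subgroup (unitaryGrp θ (diagT E d)) where
  carrier := D.congruenceSet γ
  one_mem' := ⟨0, entryLt_zero hγ, by simp⟩
  mul_mem' := by
    rintro g k ⟨y, hy, hg⟩ hk
    have hy1 : EntryLt 1 y.1 := EntryLt.mono hy hγ1
    have hdet : (1 - y.1).det ≠ 0 := by
      rw [← (valuation E).ne_zero_iff, hy1.exists_inv_sub.1]
      exact one_ne_zero
    obtain ⟨z, hz, h⟩ := D.exists_shift_of_mem_congruenceSet hγ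
      (hy1.le.mono ((one_le_inv₀ (zero_lt_iff.2 hγ)).2 hγ1)) hdet hg hk
    exact ⟨_, D.shift_mem_lattice hγ hγ1 hy hz, h⟩
  inv_mem' := by
    rintro g ⟨z, hz, hg⟩
    refine ⟨-z, EntryLt.neg hz, ?_⟩
    have h : (g⁻¹).1.1 * g.1.1 = 1 := by
      rw [← Units.val_mul, ← Subgroup.coe_mul, inv_mul_cancel]; rfl
    rw [AddSubgroup.coe_neg, sub_neg_eq_add, ← hg, ← mul_assoc, h, one_mul, sub_eq_add_neg]

lemma congruenceSet_mono (D : IsUnitaryData θ ω a d) {γ δ : ValueGroupWithZero E} (h : γ ≤ δ) :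
    D.congruenceSet γ ⊆ D.congruenceSet δ := fun _ ⟨z, hz, hk⟩ => ⟨z, EntryLt.mono hz h, hk⟩

/-! ### The Cayley transform on cosets -/

omit [ValuativeRel E] in
lemma mem_lieAlg'_iff (D : IsUnitaryData θ ω a d) (y : lieAlg θ (diagT E d)) :
    y ∈ lieAlg' θ (diagT E d) ↔ (1 - y.1).det ≠ 0 := by
  change ((1 + y.1) * (1 - y.1)).det ≠ 0 ↔ _
  rw [Matrix.det_mul, D.det_one_add y.2]
  simp

omit [ValuativeRel E] in
lemma cayley_eq_iff (D : IsUnitaryData θ ω a d) (y : lieAlg' θ (diagT E d))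
    (g : unitaryGrp θ (diagT E d)) :
    cayley θ (diagT E d) y = g ↔ g.1.1 * (1 - y.1.1) = 1 + y.1.1 := by
  have hu : IsUnit (1 - y.1.1).det := isUnit_iff_ne_zero.2 ((D.mem_lieAlg'_iff y.1).1 y.2)
  rw [Subtype.ext_iff, Units.ext_iff]
  change (1 + y.1.1) * (1 - y.1.1)⁻¹ = g.1.1 ↔ _
  constructor
  · intro h
    rw [← h, mul_assoc, Matrix.nonsing_inv_mul _ hu, mul_one]
  · intro h
    rw [← h, mul_assoc, Matrix.mul_nonsing_inv _ hu, mul_one]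

omit [ValuativeRel E] in
lemma _root_.CayleyUnitary.one_add_mul_one_sub {g y : Matrix (Fin m) (Fin m) E}
    (h : g * (1 - y) = 1 + y) : (1 + g) * (1 - y) = 2 := by
  rw [add_mul, h, one_mul, sub_add_add_cancel, one_add_one_eq_two]

omit [ValuativeRel E] in
lemma _root_.CayleyUnitary.det_mul_det_ne_zero [CharZero E] {g y : Matrix (Fin m) (Fin m) E}
    (h : g * (1 - y) = 1 + y) : (1 + g).det ≠ 0 ∧ (1 - y).det ≠ 0 := by
  have h2 : (2 : Matrix (Fin m) (Fin m) E).det ≠ 0 := by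
    rw [show (2 : Matrix (Fin m) (Fin m) E) = (2 : E) • 1 by
      rw [← one_add_one_eq_two, ← one_add_one_eq_two, add_smul, one_smul], Matrix.det_smul,
      Matrix.det_one, mul_one]
    exact pow_ne_zero _ two_ne_zero
  rwa [← one_add_mul_one_sub h, Matrix.det_mul, mul_ne_zero_iff] at h2

omit [ValuativeRel E] in
lemma _root_.CayleyUnitary.eq_of_mul_one_sub [CharZero E] {g y z : Matrix (Fin m) (Fin m) E}
    (hy : g * (1 - y) = 1 + y) (hz : g * (1 - z) = 1 + z) : y = z := by
  have hu : IsUnit (1 + g) := by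
    rw [Matrix.isUnit_iff_isUnit_det, isUnit_iff_ne_zero]
    exact (det_mul_det_ne_zero hy).1
  have h := hu.mul_left_cancel ((one_add_mul_one_sub hy).trans (one_add_mul_one_sub hz).symm)
  simpa using h

variable [CharZero E]

/-- The preimage of the coset `𝒞(y) K_γ` under the Cayley transform is
`y + (1 + y) L_γ (1 - y)`. -/
lemma cayley_mem_coset_iff (D : IsUnitaryData θ ω a d) (hγ : γ ≠ 0) (hγ1 : γ ≤ 1)
    (y w : lieAlg' θ (diagT E d)) (hy : EntryLe γ⁻¹ y.1.1) :
    cayley θ (diagT E d) w ∈ cayley θ (diagT E d) y • (D.congruenceSet γ) ↔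
      w.1 ∈ D.shift y.1 '' lattice θ d γ := by
  have hg := (D.cayley_eq_iff y _).1 rfl
  have hdet := (D.mem_lieAlg'_iff y.1).1 y.2
  constructor
  · rintro ⟨k, hk, h⟩
    obtain ⟨z, hz, h'⟩ := D.exists_shift_of_mem_congruenceSet hγ hy hdet hg hk
    refine ⟨z, hz, Subtype.ext (eq_of_mul_one_sub h' ?_)⟩
    rw [← D.cayley_eq_iff]
    exact h.symm
  · rintro ⟨z, hz, h⟩
    obtain ⟨x, hx, P, hP, -, hzx⟩ := D.exists_eq_mul_inv hγ hy hz
    have hxdet : (1 - x.1).det ≠ 0 := by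
      rw [← (valuation E).ne_zero_iff, (EntryLt.mono hx hγ1).exists_inv_sub.1]
      exact one_ne_zero
    let x' : lieAlg' θ (diagT E d) := ⟨x, (D.mem_lieAlg'_iff x).2 hxdet⟩
    have hk := (D.cayley_eq_iff x' _).1 rfl
    refine ⟨cayley θ (diagT E d) x', ⟨x, hx, hk⟩, ?_⟩
    change cayley θ _ y * cayley θ _ x' = cayley θ _ w
    symm
    rw [D.cayley_eq_iff, ← h, coe_shift, hzx]
    exact cayley_mul_cayley hg (Matrix.mul_nonsing_inv _ (isUnit_iff_ne_zero.2 hdet))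
      (Matrix.nonsing_inv_mul _ (isUnit_iff_ne_zero.2 hdet)) hk hP

omit [CharZero E] in
/-- `y + (1 + y) L_γ (1 - y)` lies in `𝔤'`. -/
lemma shift_mem_lieAlg' (D : IsUnitaryData θ ω a d) (hγ : γ ≠ 0) (hγ1 : γ ≤ 1)
    {y z : lieAlg θ (diagT E d)} (hy' : y ∈ lieAlg' θ (diagT E d)) (hy : EntryLe γ⁻¹ y.1)
    (hz : z ∈ lattice θ d γ) : D.shift y z ∈ lieAlg' θ (diagT E d) := by
  rw [D.mem_lieAlg'_iff] at hy' ⊢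
  rwa [← (valuation E).ne_zero_iff, D.valuation_det_one_sub_shift hγ hγ1 hy hz,
    (valuation E).ne_zero_iff]

end IsUnitaryData

end Congruence

/-! ### Topology of matrix spaces over a local field -/

section MatrixTopology

variable {E : Type*} [Field E] [ValuativeRel E] [TopologicalSpace E] [IsNonarchimedeanLocalField E]
  {m : ℕ} {γ : ValueGroupWithZero E}

lemma isOpen_entryLt (hγ : γ ≠ 0) : IsOpen {M : Matrix (Fin m) (Fin m) E | EntryLt γ M} := by
  simp only [EntryLt, Set.ofPred_forall]
  exact isOpen_iInter_of_finite fun i => isOpen_iInter_of_finite fun j =>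
    (isOpen_valuation_lt E hγ).preimage (continuous_id.matrix_elem i j)

lemma isCompact_entryLe : IsCompact {M : Matrix (Fin m) (Fin m) E | EntryLe γ M} := by
  have h := isCompact_univ_pi fun _ : Fin m => isCompact_univ_pi fun _ : Fin m =>
    IsNonarchimedeanLocalField.isCompact_closedBall E γ
  have h' : {M : Matrix (Fin m) (Fin m) E | EntryLe γ M} =
      Set.univ.pi fun _ => Set.univ.pi fun _ => {x | valuation E x ≤ γ} :=
    Set.ext fun M => ⟨fun hM i _ j _ => hM i j, fun hM i j => hM i trivial j trivial⟩
  rw [h']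
  exact h

lemma exists_entryLt_subset {V : Set (Matrix (Fin m) (Fin m) E)} (hV : V ∈ 𝓝 1) :
    ∃ δ : (ValueGroupWithZero E)ˣ, ∀ M, EntryLt (δ : ValueGroupWithZero E) M → 1 + M ∈ V := by
  have hcont : Continuous fun M : Matrix (Fin m) (Fin m) E => 1 + M := by fun_prop
  have h0 : (fun M : Matrix (Fin m) (Fin m) E => 1 + M) ⁻¹' V ∈ 𝓝 0 :=
    hcont.continuousAt.preimage_mem_nhds (by simpa using hV)
  have h1 : (𝓝 (0 : Fin m → Fin m → E)) =
      Filter.pi fun _ : Fin m => Filter.pi fun _ : Fin m => 𝓝 (0 : E) := by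
    simp only [← nhds_pi]; rfl
  obtain ⟨I, -, t, ht, hsub⟩ := Filter.mem_pi.1 (by rw [← h1]; exact h0)
  have h2 : ∀ i, ∃ δ : (ValueGroupWithZero E)ˣ, ∀ r : Fin m → E,
      (∀ j, valuation E (r j) < δ) → r ∈ t i := by
    intro i
    obtain ⟨J, -, t', ht', hsub'⟩ := Filter.mem_pi.1 (ht i)
    have h3 : ∀ j, ∃ δ : (ValueGroupWithZero E)ˣ, ∀ x : E, valuation E x < δ → x ∈ t' j := by
      intro j
      obtain ⟨δ, hδ, h⟩ := (IsValuativeTopology.hasBasis_nhds_zero' E).mem_iff.1 (ht' j)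
      exact ⟨Units.mk0 δ hδ, fun x hx => h hx⟩
    choose δ hδ using h3
    obtain ⟨M, hM⟩ := Finite.exists_ge δ
    exact ⟨M, fun r hr => hsub' fun j _ => hδ j _ ((hr j).trans_le (by exact_mod_cast hM j))⟩
  choose δ hδ using h2
  obtain ⟨M, hM⟩ := Finite.exists_ge δ
  exact ⟨M, fun A hA => hsub fun i _ => hδ i _ fun j => (hA i j).trans_le (by exact_mod_cast hM i)⟩

omit [TopologicalSpace E] [IsNonarchimedeanLocalField E] in
lemma exists_entryLe_inv (M : Matrix (Fin m) (Fin m) E) :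
    ∃ γ : ValueGroupWithZero E, γ ≠ 0 ∧ γ ≤ 1 ∧ EntryLe γ⁻¹ M := by
  obtain ⟨B, hB⟩ := Finite.exists_le fun p : Fin m × Fin m => valuation E (M p.1 p.2)
  have h1 : (1 : ValueGroupWithZero E) ≤ max B 1 := le_max_right _ _
  have h0 : max B 1 ≠ 0 := (zero_lt_one.trans_le h1).ne'
  refine ⟨(max B 1)⁻¹, inv_ne_zero h0, inv_le_one_of_one_le₀ h1, fun i j => ?_⟩
  rw [inv_inv]
  exact (hB (i, j)).trans (le_max_left _ _)

lemma continuousOn_matrix_inv :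
    ContinuousOn (fun M : Matrix (Fin m) (Fin m) E => M⁻¹) {M | M.det ≠ 0} := by
  simp only [Matrix.inv_def, Ring.inverse_eq_inv']
  refine ContinuousOn.smul (ContinuousOn.inv₀ ?_ fun M hM => hM) ?_
  · exact (continuous_id.matrix_det).continuousOn
  · exact (continuous_id.matrix_adjugate).continuousOn

end MatrixTopology

/-! ### Topology of `G` and `𝔤` -/

section UnitaryTopology

variable {F E : Type*}
  [Field F] [ValuativeRel F] [TopologicalSpace F] [IsNonarchimedeanLocalField F]
  [Field E] [ValuativeRel E] [TopologicalSpace E] [IsNonarchimedeanLocalField E] [CharZero E]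
  [Algebra F E] [ValuativeExtension F E]
  {m : ℕ} {θ : E ≃+* E} {ω : E} {a : F} {d : Fin m → F} {γ : ValueGroupWithZero E}

namespace IsUnitaryData

lemma continuous_adj (D : IsUnitaryData θ ω a d) :
    Continuous (adj θ d : Matrix (Fin m) (Fin m) E → Matrix (Fin m) (Fin m) E) := by
  have := D.continuous_theta
  refine continuous_matrix fun i j => ?_
  simp only [adj_apply]
  fun_prop

lemma isClosedEmbedding_lieAlg (D : IsUnitaryData θ ω a d) :
    Topology.IsClosedEmbedding
      (Subtype.val : lieAlg θ (diagT E d) → Matrix (Fin m) (Fin m) E) := by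
  refine IsClosed.isClosedEmbedding_subtypeVal ?_
  have : (lieAlg θ (diagT E d) : Set (Matrix (Fin m) (Fin m) E)) = {x | adj θ d x = -x} :=
    Set.ext fun x => D.mem_lieAlg_iff_adj
  rw [this]
  exact isClosed_eq D.continuous_adj continuous_neg

lemma isClosedEmbedding_unitaryGrp (D : IsUnitaryData θ ω a d) :
    Topology.IsClosedEmbedding
      (fun g : unitaryGrp θ (diagT E d) => (g.1.1 : Matrix (Fin m) (Fin m) E)) := by
  have hcont : Continuous
      (fun g : unitaryGrp θ (diagT E d) => (g.1.1 : Matrix (Fin m) (Fin m) E)) :=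
    Units.continuous_val.comp continuous_subtype_val
  have hadj : ∀ g : unitaryGrp θ (diagT E d), adj θ d g.1.1 = (g.1⁻¹).1 := fun g =>
    Units.eq_inv_of_mul_eq_one_right (D.mem_unitaryGrp_iff_adj.1 g.2)
  refine ⟨⟨?_, fun g h hgh => Subtype.ext (Units.ext hgh)⟩, ?_⟩
  · let e : Matrix (Fin m) (Fin m) E →
        Matrix (Fin m) (Fin m) E × (Matrix (Fin m) (Fin m) E)ᵐᵒᵖ :=
      fun x => (x, MulOpposite.op (adj θ d x))
    have he : Continuous e :=
      continuous_id.prodMk (MulOpposite.continuous_op.comp D.continuous_adj)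
    refine Topology.IsInducing.of_comp hcont he ?_
    have h := (Units.isEmbedding_embedProduct (M := Matrix (Fin m) (Fin m) E)).isInducing.comp
      (Topology.IsInducing.subtypeVal (t := (unitaryGrp θ (diagT E d) : Set (GL (Fin m) E))))
    convert! h using 1
    funext g
    simp only [e, Function.comp_apply, hadj]
    rfl
  · have : Set.range (fun g : unitaryGrp θ (diagT E d) => (g.1.1 : Matrix (Fin m) (Fin m) E)) =
        {x | adj θ d x * x = 1} := by
      ext x
      constructor
      · rintro ⟨g, rfl⟩
        exact D.mem_unitaryGrp_iff_adj.1 g.2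
      · intro hx
        exact ⟨⟨⟨x, adj θ d x, mul_eq_one_comm.1 hx, hx⟩, D.mem_unitaryGrp_iff_adj.2 hx⟩, rfl⟩
    rw [this]
    exact isClosed_eq (D.continuous_adj.mul continuous_id) continuous_const

lemma locallyCompactSpace_unitaryGrp (D : IsUnitaryData θ ω a d) :
    LocallyCompactSpace (unitaryGrp θ (diagT E d)) :=
  have : LocallyCompactSpace (Matrix (Fin m) (Fin m) E) :=
    inferInstanceAs (LocallyCompactSpace (Fin m → Fin m → E))
  D.isClosedEmbedding_unitaryGrp.locallyCompactSpace

lemma secondCountableTopology_unitaryGrp (D : IsUnitaryData θ ω a d) :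
    SecondCountableTopology (unitaryGrp θ (diagT E d)) :=
  D.isClosedEmbedding_unitaryGrp.isEmbedding.secondCountableTopology

omit [ValuativeRel F] [TopologicalSpace F] [IsNonarchimedeanLocalField F] [CharZero E]
  [ValuativeExtension F E] in
lemma isOpen_lieAlg' (D : IsUnitaryData θ ω a d) : IsOpen (lieAlg' θ (diagT E d)) := by
  have : lieAlg' θ (diagT E d) = {y | (1 - y.1).det ≠ 0} := Set.ext D.mem_lieAlg'_iff
  rw [this]
  exact isOpen_ne.preimage (continuous_const.sub continuous_subtype_val).matrix_det

lemma continuous_cayley (D : IsUnitaryData θ ω a d) : Continuous (cayley θ (diagT E d)) := by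
  rw [D.isClosedEmbedding_unitaryGrp.isInducing.continuous_iff]
  have hval : Continuous fun y : lieAlg' θ (diagT E d) => y.1.1 :=
    continuous_subtype_val.comp continuous_subtype_val
  change Continuous fun y : lieAlg' θ (diagT E d) => (1 + y.1.1) * (1 - y.1.1)⁻¹
  refine (continuous_const.add hval).mul ?_
  exact continuousOn_matrix_inv.comp_continuous (continuous_const.sub hval) fun y =>
    (D.mem_lieAlg'_iff y.1).1 y.2

omit [ValuativeRel F] [TopologicalSpace F] [IsNonarchimedeanLocalField F] [ValuativeRel E]
  [TopologicalSpace E] [IsNonarchimedeanLocalField E] [ValuativeExtension F E] in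
lemma mem_lieAlg_of_mul_one_sub (D : IsUnitaryData θ ω a d) {g : unitaryGrp θ (diagT E d)}
    {y : Matrix (Fin m) (Fin m) E} (h : g.1.1 * (1 - y) = 1 + y) :
    y ∈ lieAlg θ (diagT E d) := by
  rw [D.mem_lieAlg_iff_adj]
  have h1 := congrArg (fun M => adj θ d M * g.1.1) h
  simp only [D.adj_mul, adj_sub, adj_add, D.adj_one, mul_assoc,
    D.mem_unitaryGrp_iff_adj.1 g.2, mul_one] at h1
  have h2 : (1 - adj θ d y) * (1 - y) = (1 + adj θ d y) * (1 + y) := by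
    rw [h1, mul_assoc, h]
  have h3 : (2 : E) • (adj θ d y + y) = 0 := by
    rw [two_smul]
    have : adj θ d y + y + (adj θ d y + y) =
      (1 + adj θ d y) * (1 + y) - (1 - adj θ d y) * (1 - y) := by noncomm_ring
    rw [this, h2, sub_self]
  exact eq_neg_of_add_eq_zero_left ((smul_eq_zero.1 h3).resolve_left two_ne_zero)

omit [ValuativeRel F] [TopologicalSpace F] [IsNonarchimedeanLocalField F] [ValuativeRel E]
  [TopologicalSpace E] [IsNonarchimedeanLocalField E] [ValuativeExtension F E] in
/-- The image of the Cayley transform. -/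
lemma exists_cayley_eq_iff (D : IsUnitaryData θ ω a d) (g : unitaryGrp θ (diagT E d)) :
    (∃ y, cayley θ (diagT E d) y = g) ↔ (1 + g.1.1).det ≠ 0 := by
  constructor
  · rintro ⟨y, hy⟩
    exact (det_mul_det_ne_zero ((D.cayley_eq_iff y g).1 hy)).1
  · intro h
    have hP := Matrix.mul_nonsing_inv _ (isUnit_iff_ne_zero.2 h)
    set P := (1 + g.1.1)⁻¹
    have hg : g.1.1 * (1 - (1 - 2 * P)) = 1 + (1 - 2 * P) := by
      have : g.1.1 * P = 1 - P := by rw [← hP]; noncomm_ring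
      calc g.1.1 * (1 - (1 - 2 * P)) = 2 * (g.1.1 * P) := by noncomm_ring
        _ = 1 + (1 - 2 * P) := by rw [this]; noncomm_ring
    let y : lieAlg θ (diagT E d) := ⟨1 - 2 * P, D.mem_lieAlg_of_mul_one_sub hg⟩
    exact ⟨⟨y, (D.mem_lieAlg'_iff y).2 (det_mul_det_ne_zero hg).2⟩, (D.cayley_eq_iff _ _).2 hg⟩

lemma congruenceSet_mem_nhds (D : IsUnitaryData θ ω a d) (hγ : γ ≠ 0) (hγ1 : γ ≤ 1) :
    D.congruenceSet γ ∈ 𝓝 1 := by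
  have h2 : (2 : E) ≠ 0 := two_ne_zero
  have hv : valuation E 2 * γ ≠ 0 := mul_ne_zero (by simp) hγ
  have hopen := (isOpen_entryLt (m := m) hv).preimage
    (D.isClosedEmbedding_unitaryGrp.continuous.sub
      (continuous_const (y := (1 : Matrix (Fin m) (Fin m) E))))
  refine Filter.mem_of_superset (hopen.mem_nhds ?_) fun g hg => ?_
  · simpa using! entryLt_zero hv
  · let M : Matrix (Fin m) (Fin m) E := (2 : E)⁻¹ • (g.1.1 - 1)
    have hM : EntryLt γ M := fun i j => by
      change valuation E ((2 : E)⁻¹ * (g.1.1 - 1) i j) < γ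
      rw [map_mul, map_inv₀, inv_mul_lt_iff₀ (zero_lt_iff.2 (by simp))]
      exact hg i j
    obtain ⟨-, P, hP, -, hP1⟩ := (hM.mono hγ1).exists_inv
    have hgM : g.1.1 = 1 + M + M := by
      rw [add_assoc, ← two_smul E M, smul_smul, mul_inv_cancel₀ h2, one_smul, add_sub_cancel]
    have hMP : M * P = 1 - P := by rw [← hP]; noncomm_ring
    have hz : g.1.1 * (1 - M * P) = 1 + M * P := by
      calc g.1.1 * (1 - M * P) = (1 + M + M) * P := by rw [hMP, sub_sub_cancel, hgM]
        _ = 1 + M * P := by rw [add_mul, hP]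
    refine ⟨⟨M * P, D.mem_lieAlg_of_mul_one_sub hz⟩, ?_, hz⟩
    have := hM.mul_left hP1 hγ one_ne_zero
    rwa [mul_one] at this

lemma isOpen_congruenceSubgroup (D : IsUnitaryData θ ω a d) (hγ : γ ≠ 0) (hγ1 : γ ≤ 1) :
    IsOpen (D.congruenceSubgroup hγ hγ1 : Set (unitaryGrp θ (diagT E d))) :=
  Subgroup.isOpen_of_mem_nhds _ (D.congruenceSet_mem_nhds hγ hγ1)

lemma exists_congruenceSet_subset (D : IsUnitaryData θ ω a d) {V : Set (unitaryGrp θ (diagT E d))}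
    (hV : V ∈ 𝓝 1) {γ : ValueGroupWithZero E} (hγ : γ ≠ 0) (hγ1 : γ ≤ 1) :
    ∃ δ, δ ≠ 0 ∧ δ ≤ γ ∧ D.congruenceSet δ ⊆ V := by
  rw [D.isClosedEmbedding_unitaryGrp.isInducing.nhds_eq_comap, Filter.mem_comap] at hV
  obtain ⟨W, hW, hWV⟩ := hV
  obtain ⟨δ, hδ⟩ := exists_entryLt_subset (show W ∈ 𝓝 1 from hW)
  refine ⟨min δ γ, ?_, min_le_right _ _, ?_⟩
  · rcases min_choice (δ : ValueGroupWithZero E) γ with h | h <;> rw [h]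
    exacts [δ.ne_zero, hγ]
  rintro k ⟨z, hz, hk⟩
  obtain ⟨-, P, hP, -, hP1⟩ :=
    (EntryLt.mono hz ((min_le_right _ _).trans hγ1)).exists_inv_sub
  refine hWV ?_
  have h : k.1.1 = 1 + (z.1 + z.1) * P := by
    calc k.1.1 = k.1.1 * (1 - z.1) * P := by rw [mul_assoc, hP, mul_one]
      _ = (1 - z.1) * P + (z.1 + z.1) * P := by rw [hk]; noncomm_ring
      _ = 1 + (z.1 + z.1) * P := by rw [hP]
  rw [Set.mem_preimage, h]
  have hδz := EntryLt.mono hz (min_le_left _ _)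
  have := (hδz.add hδz).mul_left hP1 δ.ne_zero one_ne_zero
  rw [mul_one] at this
  exact hδ _ this

lemma exists_isCompact_congruenceSet_subset (D : IsUnitaryData θ ω a d) :
    ∃ C : Set (unitaryGrp θ (diagT E d)), IsCompact C ∧ D.congruenceSet 1 ⊆ C := by
  refine ⟨_, D.isClosedEmbedding_unitaryGrp.isCompact_preimage (isCompact_entryLe (γ := 1)), ?_⟩
  rintro k ⟨z, hz, hk⟩
  obtain ⟨-, P, hP, -, hP1⟩ := EntryLt.exists_inv_sub hz
  have h : k.1.1 = 1 + (z.1 + z.1) * P := by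
    calc k.1.1 = k.1.1 * (1 - z.1) * P := by rw [mul_assoc, hP, mul_one]
      _ = (1 - z.1) * P + (z.1 + z.1) * P := by rw [hk]; noncomm_ring
      _ = 1 + (z.1 + z.1) * P := by rw [hP]
  rw [Set.mem_preimage, h]
  have := (hz.add hz).mul_left hP1 one_ne_zero one_ne_zero
  rw [mul_one] at this
  exact (entryLe_one le_rfl).add this.le

omit [ValuativeRel F] [TopologicalSpace F] [IsNonarchimedeanLocalField F] [CharZero E]
  [ValuativeExtension F E] in
lemma isOpen_lattice (hγ : γ ≠ 0) : IsOpen (lattice θ d γ) :=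
  (isOpen_entryLt hγ).preimage continuous_subtype_val

variable [MeasurableSpace F] [BorelSpace F] [MeasurableSpace E] [BorelSpace E]

lemma mu_lattice_ne_zero (D : IsUnitaryData θ ω a d) (hγ : γ ≠ 0) : mu D (lattice θ d γ) ≠ 0 := by
  have := D.isAddHaarMeasure_mu
  exact (isOpen_lattice hγ).measure_ne_zero _ ⟨0, entryLt_zero hγ⟩

lemma mu_lattice_ne_top (D : IsUnitaryData θ ω a d) (hγ1 : γ ≤ 1) : mu D (lattice θ d γ) ≠ ∞ := by
  have := D.isAddHaarMeasure_mu
  refine ne_top_of_le_ne_top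
    (D.isClosedEmbedding_lieAlg.isCompact_preimage (isCompact_entryLe (γ := 1))).measure_ne_top
    (measure_mono fun z hz => (EntryLt.mono hz hγ1).le)

lemma mu_shift_image (D : IsUnitaryData θ ω a d) {y : lieAlg θ (diagT E d)}
    (hy : y ∈ lieAlg' θ (diagT E d)) (s : Set (lieAlg θ (diagT E d))) :
    mu D (D.shift y '' s) = ENNReal.ofReal (absVal (1 - y.1).det ^ m) * mu D s := by
  have := D.isAddHaarMeasure_mu
  have hdet : (1 + y.1).det ≠ 0 := by
    rw [D.det_one_add y.2]
    simpa using (D.mem_lieAlg'_iff y).1 hy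
  have h := D.mu_image_conj (Matrix.GeneralLinearGroup.mkOfDetNeZero (1 + y.1) hdet) s
  change mu D ((fun z => ⟨(1 + y.1) * z.1 * adj θ d (1 + y.1), D.mul_mul_adj_mem _ z.2⟩) '' s) =
    ENNReal.ofReal (absVal (1 + y.1).det ^ m) * mu D s at h
  rw [D.det_one_add y.2, D.absVal_theta] at h
  have hshift : D.shift y '' s = y +ᵥ ((fun z : lieAlg θ (diagT E d) =>
      (⟨(1 + y.1) * z.1 * adj θ d (1 + y.1), D.mul_mul_adj_mem _ z.2⟩ :
        lieAlg θ (diagT E d))) '' s) := by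
    rw [← Set.image_vadd, Set.image_image]
    rfl
  rw [hshift, measure_vadd, h]

end IsUnitaryData

end UnitaryTopology

/-! ### Measures that agree on cosets of small subgroups -/

section Cosets

variable {G : Type*} [Group G] [TopologicalSpace G] [IsTopologicalGroup G]

omit [TopologicalSpace G] [IsTopologicalGroup G] in
lemma smul_coe_subgroup_eq_of_mem {H : Subgroup G} {g h : G} (h' : h ∈ g • (H : Set G)) :
    g • (H : Set G) = h • (H : Set G) := by
  rw [mem_leftCoset_iff] at h'
  exact leftCoset_eq_iff H |>.2 h'

lemma countable_quotient_of_isOpen [SecondCountableTopology G] {H : Subgroup G}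
    (hH : IsOpen (H : Set G)) (K : Subgroup G) : Countable (K ⧸ H.subgroupOf K) := by
  have : DiscreteTopology (K ⧸ H.subgroupOf K) :=
    QuotientGroup.discreteTopology (hH.preimage continuous_subtype_val)
  have : TopologicalSpace.SeparableSpace (K ⧸ H.subgroupOf K) :=
    inferInstanceAs (TopologicalSpace.SeparableSpace (Quotient (QuotientGroup.leftRel _)))
  exact TopologicalSpace.separableSpace_iff_countable.1 inferInstance

variable [SecondCountableTopology G] [MeasurableSpace G] [BorelSpace G]

/-- Two finite measures that agree on the cosets of a chain of open subgroups that form a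
neighbourhood basis of `1` are equal. -/
lemma measure_ext_of_cosets {ι : Type*} (K : ι → Subgroup G)
    (hopen : ∀ i, IsOpen (K i : Set G)) (hbasis : ∀ V ∈ 𝓝 (1 : G), ∃ i, (K i : Set G) ⊆ V)
    (htot : ∀ i j, K i ≤ K j ∨ K j ≤ K i) (μ ν : Measure G) [IsFiniteMeasure μ]
    (h : ∀ (g : G) i, μ (g • (K i : Set G)) = ν (g • (K i : Set G)))
    (huniv : μ Set.univ = ν Set.univ) : μ = ν := by
  let C : Set (Set G) := {s | ∃ (g : G) (i : ι), s = g • (K i : Set G)}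
  have hC : TopologicalSpace.IsTopologicalBasis C := by
    refine TopologicalSpace.isTopologicalBasis_of_isOpen_of_nhds ?_ ?_
    · rintro _ ⟨g, i, rfl⟩
      exact (hopen i).smul g
    · intro g U hg hU
      obtain ⟨i, hi⟩ := hbasis (g⁻¹ • U) ((hU.smul g⁻¹).mem_nhds
        ⟨g, hg, inv_mul_cancel g⟩)
      exact ⟨_, ⟨g, i, rfl⟩, ⟨1, (K i).one_mem, mul_one g⟩, by
        rw [Set.smul_set_subset_iff_subset_inv_smul_set]; exact hi⟩
  have hpi : IsPiSystem C := by
    rintro _ ⟨g, i, rfl⟩ _ ⟨g', j, rfl⟩ ⟨x, hx, hx'⟩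
    rw [smul_coe_subgroup_eq_of_mem hx, smul_coe_subgroup_eq_of_mem hx']
    rcases htot i j with hij | hij
    · exact ⟨x, i, Set.inter_eq_left.2 (Set.smul_set_mono hij)⟩
    · exact ⟨x, j, Set.inter_eq_right.2 (Set.smul_set_mono hij)⟩
  refine ext_of_generate_finite C ?_ hpi ?_ huniv
  · rw [BorelSpace.measurable_eq (α := G), hC.borel_eq_generateFrom]
  · rintro _ ⟨g, i, rfl⟩
    exact h g i

end Cosets

section CayleyMeasure

variable {F E : Type*}
  [Field F] [ValuativeRel F] [TopologicalSpace F] [IsNonarchimedeanLocalField F]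
  [Field E] [ValuativeRel E] [TopologicalSpace E] [IsNonarchimedeanLocalField E] [CharZero E]
  [Algebra F E] [ValuativeExtension F E]
  {m : ℕ} {θ : E ≃+* E} {ω : E} {a : F} {d : Fin m → F} {γ : ValueGroupWithZero E}
  [MeasurableSpace F] [BorelSpace F] [MeasurableSpace E] [BorelSpace E]

omit [CharZero E] [MeasurableSpace E] [BorelSpace E] in
lemma continuousOn_absVal : ContinuousOn (absVal : E → ℝ) {x | x ≠ 0} := by
  intro x hx
  have hx' : valuation E x ≠ 0 := by simpa using hx
  refine ContinuousAt.continuousWithinAt ?_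
  have hev : ∀ᶠ y in 𝓝 x, absVal y = absVal x := by
    have hopen : IsOpen {y : E | valuation E (y - x) < valuation E x} :=
      (isOpen_valuation_lt E hx').preimage (continuous_id.sub continuous_const)
    filter_upwards [hopen.mem_nhds (by simpa using zero_lt_iff.2 hx')] with y hy
    refine absVal_eq_of_valuation_eq ?_
    have := (valuation E).map_add_eq_of_lt_left hy
    rwa [add_sub_cancel] at this
  exact Filter.EventuallyEq.continuousAt hev

namespace IsUnitaryData

/-- The density `|det (1 - y)|^{-m}` on `𝔤'`. -/
def density (_ : IsUnitaryData θ ω a d) (y : lieAlg' θ (diagT E d)) : ℝ≥0 :=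
  Real.toNNReal (absVal (1 - y.1.1).det ^ (-(m : ℤ)))

omit [ValuativeRel F] [TopologicalSpace F] [IsNonarchimedeanLocalField F]
  [CharZero E] [ValuativeExtension F E] [MeasurableSpace F] [BorelSpace F] [MeasurableSpace E]
  [BorelSpace E] in
lemma continuous_density (D : IsUnitaryData θ ω a d) : Continuous D.density := by
  have hval : Continuous fun y : lieAlg' θ (diagT E d) => (1 - y.1.1).det :=
    (continuous_const.sub (continuous_subtype_val.comp continuous_subtype_val)).matrix_det
  have h := continuousOn_absVal.comp_continuous hval fun y => (D.mem_lieAlg'_iff y.1).1 y.2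
  refine continuous_real_toNNReal.comp (h.zpow₀ _ fun y => Or.inl ?_)
  exact (absVal_pos ((D.mem_lieAlg'_iff y.1).1 y.2)).ne'

/-- The push-forward of `|det (1 - y)|^{-m} dμ(y)` under the Cayley transform. -/
def cayleyMeasure (D : IsUnitaryData θ ω a d) : Measure (unitaryGrp θ (diagT E d)) :=
  (((mu D).comap Subtype.val).withDensity fun y => (D.density y : ℝ≥0∞)).map
    (cayley θ (diagT E d))

omit [MeasurableSpace F] [BorelSpace F] [MeasurableSpace E] [BorelSpace E] in
lemma measurableSet_coset (D : IsUnitaryData θ ω a d) (hγ : γ ≠ 0) (hγ1 : γ ≤ 1)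
    (g : unitaryGrp θ (diagT E d)) : MeasurableSet (g • D.congruenceSet γ) :=
  ((D.isOpen_congruenceSubgroup hγ hγ1).smul g).measurableSet

/-- The push-forward measure of the coset `𝒞(y) K_γ` is `μ(L_γ)`. -/
lemma cayleyMeasure_coset (D : IsUnitaryData θ ω a d) (hγ : γ ≠ 0) (hγ1 : γ ≤ 1)
    (y : lieAlg' θ (diagT E d)) (hy : EntryLe γ⁻¹ y.1.1) :
    D.cayleyMeasure (cayley θ (diagT E d) y • D.congruenceSet γ) = mu D (lattice θ d γ) := by
  have hmeas := D.measurableSet_coset hγ hγ1 (cayley θ (diagT E d) y)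
  have hdet := (D.mem_lieAlg'_iff y.1).1 y.2
  set S := cayley θ (diagT E d) ⁻¹' (cayley θ (diagT E d) y • D.congruenceSet γ) with hS
  have hSm : MeasurableSet S := D.continuous_cayley.measurable hmeas
  have himage : Subtype.val '' S = D.shift y.1 '' lattice θ d γ := by
    ext w
    constructor
    · rintro ⟨w, hw, rfl⟩
      exact (D.cayley_mem_coset_iff hγ hγ1 y w hy).1 hw
    · intro hw
      have hw' : w ∈ lieAlg' θ (diagT E d) := by
        obtain ⟨z, hz, rfl⟩ := hw
        exact D.shift_mem_lieAlg' hγ hγ1 y.2 hy hz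
      exact ⟨⟨w, hw'⟩, (D.cayley_mem_coset_iff hγ hγ1 y ⟨w, hw'⟩ hy).2 hw, rfl⟩
  have hconst : ∀ w ∈ S, (D.density w : ℝ≥0∞) = D.density y := by
    intro w hw
    obtain ⟨z, hz, h⟩ := (D.cayley_mem_coset_iff hγ hγ1 y w hy).1 hw
    rw [density, density, ← h,
      absVal_eq_of_valuation_eq (D.valuation_det_one_sub_shift hγ hγ1 hy hz)]
  rw [cayleyMeasure, Measure.map_apply D.continuous_cayley.measurable hmeas, ← hS,
    withDensity_apply _ hSm, setLIntegral_congr_fun hSm hconst, setLIntegral_const,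
    comap_subtype_coe_apply D.isOpen_lieAlg'.measurableSet, himage, D.mu_shift_image y.2,
    ← mul_assoc]
  have h0 := absVal_pos hdet
  rw [density, ENNReal.ofNNReal_toNNReal, ← ENNReal.ofReal_mul (zpow_nonneg h0.le _), zpow_neg,
    zpow_natCast, inv_mul_cancel₀ (pow_ne_zero _ h0.ne'), ENNReal.ofReal_one, one_mul]

omit [ValuativeRel F] [TopologicalSpace F] [IsNonarchimedeanLocalField F] [TopologicalSpace E]
  [IsNonarchimedeanLocalField E] [ValuativeExtension F E] [MeasurableSpace F] [BorelSpace F]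
  [MeasurableSpace E] [BorelSpace E] in
lemma exists_cayley_of_mem_congruenceSet (D : IsUnitaryData θ ω a d)
    {k : unitaryGrp θ (diagT E d)} (hk : k ∈ D.congruenceSet 1) :
    ∃ y : lieAlg' θ (diagT E d), EntryLt 1 y.1.1 ∧ cayley θ (diagT E d) y = k := by
  obtain ⟨z, hz, hk⟩ := hk
  exact ⟨⟨z, (D.mem_lieAlg'_iff z).2 (det_mul_det_ne_zero hk).2⟩, hz, (D.cayley_eq_iff _ _).2 hk⟩

/-- There is a Haar measure of `G` that gives each congruence subgroup the measure of the
corresponding lattice. -/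
lemma exists_haar (D : IsUnitaryData θ ω a d) :
    ∃ ν : Measure (unitaryGrp θ (diagT E d)), ν.IsHaarMeasure ∧
      ∀ γ, γ ≠ 0 → γ ≤ 1 → ν (D.congruenceSet γ) = mu D (lattice θ d γ) := by
  have := D.locallyCompactSpace_unitaryGrp
  have := D.secondCountableTopology_unitaryGrp
  let ν₀ : Measure (unitaryGrp θ (diagT E d)) := Measure.haar
  have h1 : ν₀ (D.congruenceSet 1) ≠ 0 :=
    (Measure.measure_pos_of_mem_nhds ν₀ (D.congruenceSet_mem_nhds one_ne_zero le_rfl)).ne'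
  have h2 : ν₀ (D.congruenceSet 1) ≠ ∞ := by
    obtain ⟨C, hC, hsub⟩ := D.exists_isCompact_congruenceSet_subset
    exact ne_top_of_le_ne_top hC.measure_ne_top (measure_mono hsub)
  have hμ0 := D.mu_lattice_ne_zero (γ := 1) one_ne_zero
  have hμt := D.mu_lattice_ne_top (γ := 1) le_rfl
  let ν := (mu D (lattice θ d 1) / ν₀ (D.congruenceSet 1)) • ν₀
  have hν : ν.IsHaarMeasure :=
    Measure.IsHaarMeasure.smul ν₀ (ENNReal.div_ne_zero.2 ⟨hμ0, h2⟩) (ENNReal.div_ne_top hμt h1)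
  have hν1 : ν (D.congruenceSet 1) = mu D (lattice θ d 1) := by
    rw [Measure.smul_apply, smul_eq_mul, ENNReal.div_mul_cancel h1 h2]
  refine ⟨ν, hν, fun γ hγ hγ1 => ?_⟩
  let H := D.congruenceSubgroup hγ hγ1
  let K := D.congruenceSubgroup (γ := 1) one_ne_zero le_rfl
  have hHK : H ≤ K := D.congruenceSet_mono hγ1
  have hopen : IsOpen (H : Set (unitaryGrp θ (diagT E d))) := D.isOpen_congruenceSubgroup hγ hγ1
  have := countable_quotient_of_isOpen hopen K
  have e1 := Subgroup.measure_eq_card_of_cosets ν hHK (c := ν (D.congruenceSet γ))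
    (D.measurableSet_coset hγ hγ1) (fun k _ => measure_smul _ _ _)
  have e2 := Subgroup.measure_eq_card_of_cosets D.cayleyMeasure hHK (c := mu D (lattice θ d γ))
    (D.measurableSet_coset hγ hγ1) (fun k hk => by
      obtain ⟨y, hy, rfl⟩ := D.exists_cayley_of_mem_congruenceSet hk
      exact D.cayleyMeasure_coset hγ hγ1 y
        (hy.le.mono ((one_le_inv₀ (zero_lt_iff.2 hγ)).2 hγ1)))
  have e3 : D.cayleyMeasure (K : Set (unitaryGrp θ (diagT E d))) = mu D (lattice θ d 1) := by
    have h := D.cayleyMeasure_coset (γ := 1) one_ne_zero le_rfl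
      ⟨0, (D.mem_lieAlg'_iff _).2 (by simp)⟩ (entryLt_zero (by simp)).le
    rw [(D.cayley_eq_iff _ 1).2 (by simp), one_smul] at h
    exact h
  rw [e3] at e2
  have e4 : ν (K : Set (unitaryGrp θ (diagT E d))) = mu D (lattice θ d 1) := hν1
  rw [e4] at e1
  set n : ℝ≥0∞ := ((ENat.card (K ⧸ H.subgroupOf K) : ℕ∞) : ℝ≥0∞)
  have hn0 : n ≠ 0 := fun h => hμ0 (by rw [e2, h, zero_mul])
  have hnt : n ≠ ∞ := fun h => hμt (by
    rw [e2, h, ENNReal.top_mul (D.mu_lattice_ne_zero hγ)])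
  exact (ENNReal.mul_right_inj hn0 hnt).1 (e1.symm.trans e2)

/-- On the image of the Cayley transform, the Haar measure of `G` is the push-forward of
`|det (1 - y)|^{-m} dμ(y)`. -/
lemma cayleyMeasure_restrict (D : IsUnitaryData θ ω a d)
    (ν : Measure (unitaryGrp θ (diagT E d))) [ν.IsHaarMeasure]
    (hν : ∀ γ, γ ≠ 0 → γ ≤ 1 → ν (D.congruenceSet γ) = mu D (lattice θ d γ)) :
    D.cayleyMeasure.restrict {g | (1 + g.1.1).det ≠ 0} = ν.restrict {g | (1 + g.1.1).det ≠ 0} := by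
  have := D.secondCountableTopology_unitaryGrp
  have hlocal : ∀ (y : lieAlg' θ (diagT E d)) (γ : ValueGroupWithZero E), γ ≠ 0 → γ ≤ 1 →
      EntryLe γ⁻¹ y.1.1 →
      D.cayleyMeasure.restrict (cayley θ (diagT E d) y • D.congruenceSet γ) =
        ν.restrict (cayley θ (diagT E d) y • D.congruenceSet γ) := by
    intro y γ hγ hγ1 hy
    set S := cayley θ (diagT E d) y • D.congruenceSet γ with hS
    have huniv : D.cayleyMeasure S = ν S := by
      rw [hS, D.cayleyMeasure_coset hγ hγ1 y hy, measure_smul, hν γ hγ hγ1]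
    have hfin : IsFiniteMeasure (D.cayleyMeasure.restrict S) := ⟨by
      rw [Measure.restrict_apply_univ, D.cayleyMeasure_coset hγ hγ1 y hy]
      exact (D.mu_lattice_ne_top hγ1).lt_top⟩
    let K : {δ : ValueGroupWithZero E // δ ≠ 0 ∧ δ ≤ γ} → Subgroup (unitaryGrp θ (diagT E d)) :=
      fun δ => D.congruenceSubgroup δ.2.1 (δ.2.2.trans hγ1)
    refine measure_ext_of_cosets K (fun δ => D.isOpen_congruenceSubgroup _ _) (fun V hV => ?_)
      (fun δ ε => ?_) _ _ (fun g δ => ?_) ?_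
    · obtain ⟨δ, h0, h1, h⟩ := D.exists_congruenceSet_subset hV hγ hγ1
      exact ⟨⟨δ, h0, h1⟩, h⟩
    · exact (le_total δ.1 ε.1).imp (fun h => D.congruenceSet_mono h)
        (fun h => D.congruenceSet_mono h)
    · have hm := D.measurableSet_coset δ.2.1 (δ.2.2.trans hγ1) g
      change D.cayleyMeasure.restrict S (g • D.congruenceSet δ.1) =
        ν.restrict S (g • D.congruenceSet δ.1)
      rw [Measure.restrict_apply hm, Measure.restrict_apply hm]
      rcases Set.eq_empty_or_nonempty (g • D.congruenceSet δ.1 ∩ S) with h | ⟨x, hx, hxS⟩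
      · rw [h, measure_empty, measure_empty]
      · have hSx : S = x • D.congruenceSet γ :=
          smul_coe_subgroup_eq_of_mem (H := D.congruenceSubgroup hγ hγ1) hxS
        have hgx : g • D.congruenceSet δ.1 = x • D.congruenceSet δ.1 :=
          smul_coe_subgroup_eq_of_mem (H := K δ) hx
        have hsub : x • D.congruenceSet δ.1 ⊆ S := by
          rw [hSx]
          exact Set.smul_set_mono (D.congruenceSet_mono δ.2.2)
        obtain ⟨k, hk, hkx⟩ := hxS
        obtain ⟨z, hz, hw⟩ := D.exists_shift_of_mem_congruenceSet hγ hy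
          ((D.mem_lieAlg'_iff y.1).1 y.2) ((D.cayley_eq_iff y _).1 rfl) hk
        let w : lieAlg' θ (diagT E d) := ⟨D.shift y.1 z, D.shift_mem_lieAlg' hγ hγ1 y.2 hy hz⟩
        have hwx : cayley θ (diagT E d) w = x := by
          rw [D.cayley_eq_iff, ← hkx]; exact hw
        rw [hgx, Set.inter_eq_left.2 hsub, ← hwx,
          D.cayleyMeasure_coset δ.2.1 (δ.2.2.trans hγ1) w ?_, measure_smul,
          hν _ δ.2.1 (δ.2.2.trans hγ1)]
        exact (D.entryLe_shift hγ hγ1 hy hz).mono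
          (inv_anti₀ (zero_lt_iff.2 δ.2.1) δ.2.2)
    · rw [Measure.restrict_apply_univ, Measure.restrict_apply_univ, huniv]
  choose c hc0 hc1 hc using fun y : lieAlg' θ (diagT E d) => exists_entryLe_inv y.1.1
  let s : lieAlg' θ (diagT E d) → Set (unitaryGrp θ (diagT E d)) :=
    fun y => cayley θ (diagT E d) y • D.congruenceSet (c y)
  have hU : {g : unitaryGrp θ (diagT E d) | (1 + g.1.1).det ≠ 0} = ⋃ y, s y := by
    ext g
    rw [Set.mem_ofPred_eq, ← D.exists_cayley_eq_iff, Set.mem_iUnion]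
    constructor
    · rintro ⟨y, rfl⟩
      exact ⟨y, 1, (D.congruenceSubgroup (hc0 y) (hc1 y)).one_mem, mul_one _⟩
    · rintro ⟨y, k, hk, rfl⟩
      obtain ⟨z, hz, hw⟩ := D.exists_shift_of_mem_congruenceSet (hc0 y) (hc y)
        ((D.mem_lieAlg'_iff y.1).1 y.2) ((D.cayley_eq_iff y _).1 rfl) hk
      exact ⟨⟨_, D.shift_mem_lieAlg' (hc0 y) (hc1 y) y.2 (hc y) hz⟩, (D.cayley_eq_iff _ _).2 hw⟩
  obtain ⟨T, hT, hTU⟩ := TopologicalSpace.isOpen_iUnion_countable s fun y =>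
    (D.isOpen_congruenceSubgroup (hc0 y) (hc1 y)).smul _
  rw [hU, ← hTU]
  exact (Measure.restrict_biUnion_congr hT).2 fun y _ => hlocal y (c y) (hc0 y) (hc1 y) (hc y)

end IsUnitaryData

end CayleyMeasure

/-! ### The complement of the image of the Cayley transform -/

section Null

variable {F E : Type*}
  [Field F] [ValuativeRel F] [TopologicalSpace F] [IsNonarchimedeanLocalField F]
  [Field E] [ValuativeRel E] [TopologicalSpace E] [IsNonarchimedeanLocalField E] [CharZero E]
  [Algebra F E] [ValuativeExtension F E]
  {m : ℕ} {θ : E ≃+* E} {ω : E} {a : F} {d : Fin m → F}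

omit [CharZero E] in
lemma exists_valuation_algebraMap_mul_lt_one (x : E) :
    ∃ s : F, s ≠ 0 ∧ valuation E (algebraMap F E s * x) < 1 := by
  have hcont : Continuous fun s : F => algebraMap F E s * x :=
    (continuous_algebraMap_of_valuativeExtension (F := F) (E := E)).mul continuous_const
  have hU : {s : F | valuation E (algebraMap F E s * x) < 1} ∈ 𝓝 0 :=
    ((isOpen_valuation_lt E one_ne_zero).preimage hcont).mem_nhds (by simp)
  obtain ⟨δ, hδ, hsub⟩ := (IsValuativeTopology.hasBasis_nhds_zero' F).mem_iff.1 hU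
  obtain ⟨r, rfl⟩ := valuation_surjective δ
  obtain ⟨ϖ, hϖ0, hϖ⟩ := Valuation.IsNontrivial.exists_lt_one (v := valuation F)
  have hr : r ≠ 0 := by simpa using hδ
  have hϖ0 : ϖ ≠ 0 := by simpa using hϖ0
  refine ⟨r * ϖ, mul_ne_zero hr hϖ0, hsub ?_⟩
  simp only [Set.mem_ofPred_eq, map_mul]
  exact mul_lt_of_lt_one_right (zero_lt_iff.2 hδ) hϖ

namespace IsUnitaryData

/-- The congruence subgroup of level `1` contains infinitely many scalar matrices. -/
lemma exists_scalar_mem_congruenceSet (D : IsUnitaryData θ ω a d) :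
    ∃ (k : ℕ → unitaryGrp θ (diagT E d)) (u : ℕ → E), Function.Injective u ∧
      ∀ n, k n ∈ D.congruenceSet 1 ∧ (k n).1.1 = u n • (1 : Matrix (Fin m) (Fin m) E) := by
  obtain ⟨s, hs0, hs⟩ := exists_valuation_algebraMap_mul_lt_one (F := F) ω
  set x : E := algebraMap F E s * ω with hx
  have hx0 : x ≠ 0 := mul_ne_zero (by simpa using hs0) D.omega_ne_zero
  have hθx : ∀ n : ℕ, θ (n * x) = -(n * x) := fun n => by
    rw [map_mul, map_natCast, hx, map_mul, D.map_algebraMap, D.theta_omega]; ring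
  have hv : ∀ n : ℕ, valuation E (n * x) < 1 := fun n => by
    rw [map_mul]
    refine mul_lt_one_of_nonneg_of_lt_one_right ?_ zero_le hs
    induction n with
    | zero => simp
    | succ n ih =>
      rw [Nat.cast_succ]
      exact (valuation E).map_add_le ih (by simp)
  have hne : ∀ n : ℕ, (1 : E) - n * x ≠ 0 := fun n h => by
    have h1 := hv n
    rw [← sub_eq_zero.1 h, map_one] at h1
    exact lt_irrefl _ h1
  let z : ℕ → lieAlg θ (diagT E d) := fun n => ⟨(n * x) • 1, by
    rw [mem_lieAlg_iff]
    intro i j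
    by_cases hij : i = j
    · subst hij
      simp only [Matrix.smul_apply, Matrix.one_apply_eq, smul_eq_mul, mul_one, hθx]
      ring
    · simp [Matrix.one_apply_ne hij, Matrix.one_apply_ne (Ne.symm hij)]⟩
  have hz : ∀ n, EntryLt 1 (z n).1 := fun n i j => by
    change valuation E ((n * x) * (1 : Matrix (Fin m) (Fin m) E) i j) < 1
    rw [Matrix.one_apply]
    split_ifs
    · rw [mul_one]; exact hv n
    · simp
  have hsub : ∀ n, 1 - (z n).1 = ((1 : E) - n * x) • 1 := fun n => by
    rw [sub_smul, one_smul]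
  have hdet : ∀ n, z n ∈ lieAlg' θ (diagT E d) := fun n => by
    rw [D.mem_lieAlg'_iff, hsub, Matrix.det_smul, Matrix.det_one, mul_one]
    exact pow_ne_zero _ (hne n)
  have hk : ∀ n, (cayley θ (diagT E d) ⟨z n, hdet n⟩).1.1 * (1 - (z n).1) = 1 + (z n).1 :=
    fun n => (D.cayley_eq_iff ⟨z n, hdet n⟩ _).1 rfl
  refine ⟨fun n => cayley θ (diagT E d) ⟨z n, hdet n⟩,
    fun n => (1 + n * x) / (1 - n * x), fun n n' h => ?_, fun n => ⟨⟨z n, hz n, hk n⟩, ?_⟩⟩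
  · simp only at h
    rw [div_eq_div_iff (hne n) (hne n')] at h
    have h1 : ((n : E) - n') * (2 * x) = 0 := by linear_combination h
    have h2 := (mul_eq_zero.1 h1).resolve_right (mul_ne_zero two_ne_zero hx0)
    exact_mod_cast sub_eq_zero.1 h2
  · have h1 := hk n
    rw [hsub, Matrix.mul_smul, mul_one] at h1
    have h2 : 1 + (z n).1 = ((1 : E) + n * x) • 1 := by rw [add_smul, one_smul]
    rw [h2] at h1
    have h3 := congrArg (((1 : E) - n * x)⁻¹ • ·) h1
    simp only [smul_smul, inv_mul_cancel₀ (hne n), one_smul] at h3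
    simp only [h3, div_eq_inv_mul]

lemma measure_null_inter_coset (D : IsUnitaryData θ ω a d)
    (ν : Measure (unitaryGrp θ (diagT E d))) [ν.IsHaarMeasure] (g : unitaryGrp θ (diagT E d)) :
    ν ({h | (1 + h.1.1).det = 0} ∩ g • D.congruenceSet 1) = 0 := by
  obtain ⟨k, u, hu, hk⟩ := D.exists_scalar_mem_congruenceSet
  classical
  set V := g • D.congruenceSet 1 with hV
  set N : Set (unitaryGrp θ (diagT E d)) := {h | (1 + h.1.1).det = 0}
  have hVm : MeasurableSet V := D.measurableSet_coset one_ne_zero le_rfl g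
  have hNm : MeasurableSet N :=
    (isClosed_singleton.preimage
      (continuous_const.add D.isClosedEmbedding_unitaryGrp.continuous).matrix_det).measurableSet
  have hVfin : ν V ≠ ∞ := by
    obtain ⟨C, hC, hsub⟩ := D.exists_isCompact_congruenceSet_subset
    rw [hV, measure_smul]
    exact ne_top_of_le_ne_top hC.measure_ne_top (measure_mono hsub)
  have hSm : ∀ n, MeasurableSet (k n • (N ∩ V)) := fun n => (hNm.inter hVm).const_smul _
  have hcomm : ∀ n (h : unitaryGrp θ (diagT E d)), k n * h = h * k n := fun n h => by
    refine Subtype.ext (Units.ext ?_)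
    change (k n).1.1 * h.1.1 = h.1.1 * (k n).1.1
    rw [(hk n).2, Matrix.smul_mul, Matrix.mul_smul, one_mul, mul_one]
  have hSV : ∀ n, k n • (N ∩ V) ⊆ V := by
    rintro n _ ⟨h, ⟨-, l, hl, rfl⟩, rfl⟩
    refine ⟨k n * l,
      (D.congruenceSubgroup (γ := 1) one_ne_zero le_rfl).mul_mem (hk n).1 hl, ?_⟩
    change g * (k n * l) = k n * (g * l)
    rw [← mul_assoc, ← hcomm, mul_assoc]
  have hroot : ∀ n (h : unitaryGrp θ (diagT E d)), h ∈ k n • (N ∩ V) →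
      -u n ∈ h.1.1.charpoly.roots.toFinset := by
    rintro n _ ⟨h, ⟨hN, -⟩, rfl⟩
    rw [Multiset.mem_toFinset, Polynomial.mem_roots (Matrix.charpoly_monic _).ne_zero,
      Polynomial.IsRoot.def, Matrix.eval_charpoly]
    have : Matrix.scalar (Fin m) (-u n) - (k n * h).1.1 = (-u n) • (1 + h.1.1) := by
      change _ - (k n).1.1 * h.1.1 = _
      rw [(hk n).2, Matrix.smul_mul, one_mul, smul_add, neg_smul, neg_smul, sub_eq_add_neg, ← neg_smul (u n) 1,
        Matrix.smul_one_eq_diagonal]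
      rfl
    change (Matrix.scalar (Fin m) (-u n) - (k n * h).1.1).det = 0
    rw [this, Matrix.det_smul, show (1 + h.1.1).det = 0 from hN, mul_zero]
  have hbound : ∀ M : ℕ, (M : ℝ≥0∞) * ν (N ∩ V) ≤ m * ν V := by
    intro M
    calc (M : ℝ≥0∞) * ν (N ∩ V) = ∑ n ∈ Finset.range M, ν (k n • (N ∩ V)) := by
          simp only [measure_smul, Finset.sum_const, Finset.card_range, nsmul_eq_mul]
      _ = ∫⁻ h, ∑ n ∈ Finset.range M, (k n • (N ∩ V)).indicator 1 h ∂ν := by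
          rw [lintegral_finsetSum _ fun n _ => measurable_one.indicator (hSm n)]
          exact Finset.sum_congr rfl fun n _ => (lintegral_indicator_one (hSm n)).symm
      _ ≤ ∫⁻ h, V.indicator (fun _ => (m : ℝ≥0∞)) h ∂ν := by
          refine lintegral_mono fun h => ?_
          by_cases hhV : h ∈ V
          · rw [Set.indicator_of_mem hhV]
            simp only [Set.indicator_apply, Pi.one_apply, Finset.sum_boole]
            norm_cast
            calc ((Finset.range M).filter fun n => h ∈ k n • (N ∩ V)).card
                ≤ h.1.1.charpoly.roots.toFinset.card :=
                  Finset.card_le_card_of_injOn (fun n => -u n)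
                    (fun n hn => hroot n h (Finset.mem_filter.1 hn).2)
                    (fun n _ n' _ hnn' => hu (neg_injective hnn'))
              _ ≤ h.1.1.charpoly.natDegree :=
                  (Multiset.toFinset_card_le _).trans (Polynomial.card_roots' _)
              _ = m := by rw [Matrix.charpoly_natDegree_eq_dim, Fintype.card_fin]
          · refine le_of_eq_of_le (Finset.sum_eq_zero fun n _ => ?_) zero_le
            exact Set.indicator_of_notMem (fun h' => hhV (hSV n h')) _
      _ = m * ν V := by rw [lintegral_indicator_const hVm]
  by_contra h0
  obtain ⟨M, hM⟩ := ENNReal.exists_nat_mul_gt h0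
    (ENNReal.mul_ne_top (ENNReal.natCast_ne_top m) hVfin)
  exact absurd (hbound M) (not_le.2 hM)

/-- The complement of the image of the Cayley transform is a null set. -/
lemma measure_det_one_add_eq_zero (D : IsUnitaryData θ ω a d)
    (ν : Measure (unitaryGrp θ (diagT E d))) [ν.IsHaarMeasure] :
    ν {h | (1 + h.1.1).det = 0} = 0 := by
  have := D.secondCountableTopology_unitaryGrp
  refine measure_null_of_locally_null _ fun g hg => ?_
  refine ⟨_, Filter.inter_mem self_mem_nhdsWithin (mem_nhdsWithin_of_mem_nhds ?_),
    D.measure_null_inter_coset ν g⟩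
  exact ((D.isOpen_congruenceSubgroup (γ := 1) one_ne_zero le_rfl).smul g).mem_nhds
    ⟨1, Subgroup.one_mem _, mul_one g⟩

lemma absVal_detG (D : IsUnitaryData θ ω a d) (g : unitaryGrp θ (diagT E d)) :
    absVal (detG θ (diagT E d) g) = 1 := by
  have h := congrArg (fun M => absVal (Matrix.det M)) (D.mem_unitaryGrp_iff_adj.1 g.2)
  simp only [Matrix.det_mul, D.det_adj, absVal_mul, D.absVal_theta, Matrix.det_one,
    absVal_one] at h
  rw [← sq] at h
  exact (pow_eq_one_iff_of_nonneg (absVal_nonneg _) two_ne_zero).1 h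

variable [MeasurableSpace F] [BorelSpace F] [MeasurableSpace E] [BorelSpace E]

/-- The Haar measure of `G` is the push-forward of `|det (1 - y)|^{-m} dμ(y)`. -/
lemma cayleyMeasure_eq (D : IsUnitaryData θ ω a d)
    (ν : Measure (unitaryGrp θ (diagT E d))) [ν.IsHaarMeasure]
    (hν : ∀ γ, γ ≠ 0 → γ ≤ 1 → ν (D.congruenceSet γ) = mu D (lattice θ d γ)) :
    D.cayleyMeasure = ν := by
  have h := D.cayleyMeasure_restrict ν hν
  have hclosed : IsClosed {g : unitaryGrp θ (diagT E d) | (1 + g.1.1).det = 0} :=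
    isClosed_singleton.preimage
      (continuous_const.add D.isClosedEmbedding_unitaryGrp.continuous).matrix_det
  have h1 : ν.restrict {g | (1 + g.1.1).det ≠ 0} = ν := by
    refine Measure.restrict_eq_self_of_ae_mem ?_
    rw [ae_iff]
    simpa using D.measure_det_one_add_eq_zero ν
  have h2 : D.cayleyMeasure.restrict {g | (1 + g.1.1).det ≠ 0} = D.cayleyMeasure := by
    refine Measure.restrict_eq_self_of_ae_mem ?_
    rw [ae_iff, cayleyMeasure, Measure.map_apply D.continuous_cayley.measurable]
    · have he : cayley θ (diagT E d) ⁻¹' {x | ¬ x ∈ {g | (1 + g.1.1).det ≠ 0}} = ∅ :=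
        Set.eq_empty_iff_forall_notMem.2 fun y hy => hy ((D.exists_cayley_eq_iff _).1 ⟨y, rfl⟩)
      rw [he, measure_empty]
    · simpa using hclosed.measurableSet
  rw [← h1, ← h, h2]

lemma integral_cayley (D : IsUnitaryData θ ω a d) {f : unitaryGrp θ (diagT E d) → ℂ}
    (hf : Continuous f) :
    ∫ y : lieAlg' θ (diagT E d), f (cayley θ (diagT E d) y) *
      ((absVal (1 - y.1.1).det ^ (-(m : ℤ)) : ℝ) : ℂ) ∂((mu D).comap Subtype.val) =
      ∫ h, f h ∂D.cayleyMeasure := by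
  have := D.secondCountableTopology_unitaryGrp
  rw [cayleyMeasure, integral_map D.continuous_cayley.measurable.aemeasurable
    hf.aestronglyMeasurable,
    integral_withDensity_eq_integral_smul D.continuous_density.measurable]
  refine integral_congr_ae (Filter.Eventually.of_forall fun y => ?_)
  simp only [density, NNReal.smul_def, Complex.real_smul,
    Real.coe_toNNReal _ (zpow_nonneg (absVal_nonneg _) _)]
  ring

end IsUnitaryData

end Null

end

end CayleyUnitary

theorem mainTheorem7
    {F E : Type*}
    [Field F] [ValuativeRel F] [TopologicalSpace F] [IsNonarchimedeanLocalField F]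
    [MeasurableSpace F] [BorelSpace F]
    [Field E] [ValuativeRel E] [TopologicalSpace E] [IsNonarchimedeanLocalField E]
    [MeasurableSpace E] [BorelSpace E] [CharZero E]
    [Algebra F E] [ValuativeExtension F E]
    {m : ℕ} {θ : E ≃+* E} {ω : E} {a : F} {d : Fin m → F}
    (D : IsUnitaryData θ ω a d) :
    ∃ ν : Measure (unitaryGrp θ (diagT E d)), ν.IsHaarMeasure ∧
      ∀ f : unitaryGrp θ (diagT E d) → ℂ, IsLocallyConstant f → HasCompactSupport f →
        Integrable
          (Function.extend Subtype.val
            (fun y : lieAlg' θ (diagT E d) =>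
              ‖f (cayley θ (diagT E d) y)‖ *
                absVal (1 - (y.1 : Matrix (Fin m) (Fin m) E)).det ^ (-(m : ℤ)))
            0)
          (mu D) →
        (∫ y : lieAlg' θ (diagT E d),
            f (cayley θ (diagT E d) y) *
              ((absVal (1 - (y.1 : Matrix (Fin m) (Fin m) E)).det ^ (-(m : ℤ)) : ℝ) : ℂ)
            ∂((mu D).comap Subtype.val)
          = ∫ h, f h * ((absVal (detG θ (diagT E d) h) ^ ((m : ℝ) / 2) : ℝ) : ℂ) ∂ν) ∧
        (∫ h, f h * ((absVal (detG θ (diagT E d) h) ^ ((m : ℝ) / 2) : ℝ) : ℂ) ∂ν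
          = ∫ h, f h ∂ν) := by
  obtain ⟨ν, hν, hνμ⟩ := D.exists_haar
  refine ⟨ν, hν, fun f hf _ _ => ?_⟩
  have h2 : (∫ h, f h * ((absVal (detG θ (diagT E d) h) ^ ((m : ℝ) / 2) : ℝ) : ℂ) ∂ν) =
      ∫ h, f h ∂ν := by
    simp [D.absVal_detG]
  refine ⟨?_, h2⟩
  rw [h2, D.integral_cayley hf.continuous, D.cayleyMeasure_eq ν hνμ]
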